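/- Let $0<\delta<1/2$, $\Theta=[\delta,1-\delta]^2$, $\theta^*=(\alpha^*,\beta^*)\in\Theta$ and $E\subseteq\mathbb R$. Let $X=(X_i)_{i\ge1}$, $Y^0=(Y^0_i)_{i\ge1}$, $Y^1=(Y^1_i)_{i\ge1}$ be independent processes such that $X$ is a stationary Markov chain on $\{0,1\}$ with transition matrix $\begin{pmatrix}1-\alpha^*&\alpha^*\\ \beta^*&1-\beta^*\end{pmatrix}$, $Y^0$ is an $E$-valued strictly stationary mixing process (mixing in the sense of ergodic theory, i.e. $P(Y^0\in A,\,(Y^0_{i+k})_{i\ge1}\in B)\to P(Y^0\in A)P(Y^0\in B)$ as $k\to\infty$ for all measurable $A,B\subseteq E^{\mathbb N}$; this is implied by $\alpha$-mixing), and $Y^1$ is an $E$-valued i.i.d. sequence. The observed process is $Z_i=\mathbf 1_{\{X_i=0\}}Y^0_i+\mathbf 1_{\{X_i=1\}}Y^1_i$, $i\ge1$. Let $F^j(x)=P(Y^j_1\le x)$ for $j=0,1$, let $G^0(x,y)=P(Y^0_1\le x,Y^0_2\le y)$, and let $H$ be a probability measure on $E\times E$. Write $(\phi\otimes\psi)(x,y)=\phi(x)\psi(y)$.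 For $\theta=(\alpha,\beta)\in\Theta$ put $p=\frac{\beta}{\alpha+\beta}$, $r=\frac{\alpha}{\alpha+\beta}$, $\lambda_1=\frac{\beta(1-\alpha)}{\alpha+\beta}$, $\lambda_2=\lambda_3=\frac{\alpha\beta}{\alpha+\beta}$, $\lambda_4=\frac{\alpha(1-\beta)}{\alpha+\beta}$, and for $n\ge2$, $x,y\in E$, $$\hat F_n(x)=\frac1n\sum_{i=1}^n\mathbf 1_{\{Z_i\le x\}},\qquad \hat G_n(x,y)=\frac1{n-1}\sum_{i=1}^{n-1}\mathbf 1_{\{Z_i\le x,\,Z_{i+1}\le y\}},\qquad \hat F^1_{n,\theta}(x)=\frac1r\bigl(\hat F_n(x)-pF^0(x)\bigr),$$ $$\Delta_n(\theta,\cdot)=\hat G_n-\bigl[\lambda_1G^0+\lambda_2F^0\otimes\hat F^1_{n,\theta}+\lambda_3\hat F^1_{n,\theta}\otimes F^0+\lambda_4\hat F^1_{n,\theta}\otimes\hat F^1_{n,\theta}\bigr],$$ $$\mathbf d_n(\theta)=\iint\Delta_n^2(\theta,x,y)\,dH(x,y),\qquad \mathbf s_n(\theta)=\sup_{(x,y)\in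 E^2}|\Delta_n(\theta,x,y)|.$$ Assume that $(Z_i)_{i\ge1}$ is stationary and that LinInd holds: for every measurable $\Gamma\subseteq E\times E$ with $H(\Gamma)=1$, the restrictions to $\Gamma$ of the functions $G^0-F^0\otimes F^0$ and $(F^1-F^0)\otimes(F^1-F^0)$ are linearly independent. Then $\mathbf d_n$ and $\mathbf s_n$ attain their minima over $\Theta$ for all $n\ge2$, and the minimum-contrast estimators $\hat\theta_n\in\operatorname{argmin}_{\theta\in\Theta}\mathbf d_n(\theta)$ and $\tilde\theta_n\in\operatorname{argmin}_{\theta\in\Theta}\mathbf s_n(\theta)$ (whatever the choice of minimizers) are strongly consistent: $$\hat\theta_n\xrightarrow{\text{a.s.}}\theta^*\quad\text{and}\quad\tilde\theta_n\xrightarrow{\text{a.s.}}\theta^*\qquad(n\to\infty).$$ -/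

import Mathlib

open MeasureTheory ProbabilityTheory Filter Topology

noncomputable section

namespace Poisoning

/-! Time is indexed by `ℕ`, starting from `0`: the first observation is `Z 0`. -/

section Processes

variable {Ω S : Type*} [MeasurableSpace Ω] [MeasurableSpace S]

/-- Strict stationarity: the law of the whole trajectory is invariant under the time shift. -/
def IsStationaryProcess (P : Measure Ω) (Y : ℕ → Ω → S) : Prop :=
  P.map (fun ω (i : ℕ) => Y (i + 1) ω) = P.map (fun ω (i : ℕ) => Y i ω)

/-- Mixing (in the sense of ergodic theory) of a stationary process: an event on the trajectory and
an event on the trajectory from time `k` on are asymptotically independent as `k → ∞`. This is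
implied by strong (`α`-)mixing, hence by `β`-, `ρ`- and `φ`-mixing. -/
def IsMixingProcess (P : Measure Ω) (Y : ℕ → Ω → S) : Prop :=
  ∀ A B : Set (ℕ → S), MeasurableSet A → MeasurableSet B →
    Tendsto (fun k : ℕ => P.real {ω | (fun i => Y i ω) ∈ A ∧ (fun i => Y (i + k) ω) ∈ B}) atTop
      (𝓝 (P.real {ω | (fun i => Y i ω) ∈ A} * P.real {ω | (fun i => Y i ω) ∈ B}))

/-- Independent and identically distributed sequence. -/
def IsIIDProcess (P : Measure Ω) (Y : ℕ → Ω → S) : Prop :=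
  iIndepFun Y P ∧ ∀ i, IdentDistrib (Y i) (Y 0) P P

/-- Homogeneous Markov chain on `{0, 1}` with initial distribution `μ` and transition matrix `Q`,
through its finite-dimensional distributions. -/
def IsMarkovChainWith (P : Measure Ω) (X : ℕ → Ω → Fin 2) (μ : Fin 2 → ℝ)
    (Q : Matrix (Fin 2) (Fin 2) ℝ) : Prop :=
  ∀ (n : ℕ) (s : ℕ → Fin 2),
    P.real {ω | ∀ i ≤ n, X i ω = s i} = μ (s 0) * ∏ i ∈ Finset.range n, Q (s i) (s (i + 1))

end Processes

section Parameters

/-! A parameter is a pair `θ = (α, β)`. -/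

/-- The parameter space `Θ = [δ, 1 - δ]²`. -/
def paramSpace (δ : ℝ) : Set (ℝ × ℝ) := Set.Icc δ (1 - δ) ×ˢ Set.Icc δ (1 - δ)

/-- The transition matrix `Π_θ`. -/
def transMatrix (θ : ℝ × ℝ) : Matrix (Fin 2) (Fin 2) ℝ := !![1 - θ.1, θ.1; θ.2, 1 - θ.2]

/-- `p = β / (α + β)`. -/
def pOf (θ : ℝ × ℝ) : ℝ := θ.2 / (θ.1 + θ.2)

/-- `r = α / (α + β)`. -/
def rOf (θ : ℝ × ℝ) : ℝ := θ.1 / (θ.1 + θ.2)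

/-- The invariant probability vector of `Π_θ`. -/
def invariantVec (θ : ℝ × ℝ) : Fin 2 → ℝ := ![pOf θ, rOf θ]

def lam1 (θ : ℝ × ℝ) : ℝ := θ.2 * (1 - θ.1) / (θ.1 + θ.2)

def lam2 (θ : ℝ × ℝ) : ℝ := θ.1 * θ.2 / (θ.1 + θ.2)

def lam3 (θ : ℝ × ℝ) : ℝ := θ.1 * θ.2 / (θ.1 + θ.2)

def lam4 (θ : ℝ × ℝ) : ℝ := θ.1 * (1 - θ.2) / (θ.1 + θ.2)

end Parameters

section Model

variable {Ω : Type*} [MeasurableSpace Ω] {E : Set ℝ}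

/-- The observed process: `Z_i = Y⁰_i` if `X_i = 0` and `Z_i = Y¹_i` if `X_i = 1`. -/
def observed (X : ℕ → Ω → Fin 2) (Y0 Y1 : ℕ → Ω → E) : ℕ → Ω → E :=
  fun i ω => if X i ω = 0 then Y0 i ω else Y1 i ω

/-- The gold standard process poisoning model with true parameter `θ`. -/
structure IsPoisoningModel (P : Measure Ω) (θ : ℝ × ℝ) (X : ℕ → Ω → Fin 2)
    (Y0 Y1 : ℕ → Ω → E) : Prop where
  measurable_X : ∀ i, Measurable (X i)
  measurable_Y0 : ∀ i, Measurable (Y0 i)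
  measurable_Y1 : ∀ i, Measurable (Y1 i)
  /-- the selection process is a stationary Markov chain with transition matrix `Π_θ` -/
  markov_X : IsMarkovChainWith P X (invariantVec θ) (transMatrix θ)
  /-- the gold standard process is stationary and mixing -/
  stationary_Y0 : IsStationaryProcess P Y0
  mixing_Y0 : IsMixingProcess P Y0
  /-- the poisoning process is i.i.d. -/
  iid_Y1 : IsIIDProcess P Y1
  /-- the three processes are mutually independent: `X` is independent of `(Y⁰, Y¹)`, and `Y⁰` is
  independent of `Y¹` -/
  indep_X : IndepFun (fun ω (i : ℕ) => X i ω)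
    (fun ω => ((fun i : ℕ => Y0 i ω), (fun i : ℕ => Y1 i ω))) P
  indep_Y : IndepFun (fun ω (i : ℕ) => Y0 i ω) (fun ω (i : ℕ) => Y1 i ω) P

/-- First order cdf of a stationary process. -/
def cdf1 (P : Measure Ω) (Y : ℕ → Ω → E) (x : E) : ℝ := P.real {ω | Y 0 ω ≤ x}

/-- Second order cdf of a stationary process. -/
def cdf2 (P : Measure Ω) (Y : ℕ → Ω → E) (x y : E) : ℝ := P.real {ω | Y 0 ω ≤ x ∧ Y 1 ω ≤ y}

/-- Linear independence, on every set of full `H`-measure, of `G⁰ - F⁰ ⊗ F⁰` and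
`(F¹ - F⁰) ⊗ (F¹ - F⁰)`. -/
def LinInd (H : Measure (E × E)) (F0 F1 : E → ℝ) (G0 : E → E → ℝ) : Prop :=
  ∀ Γ : Set (E × E), MeasurableSet Γ → H Γ = 1 →
    LinearIndependent ℝ
      ![fun z : Γ => G0 z.1.1 z.1.2 - F0 z.1.1 * F0 z.1.2,
        fun z : Γ => (F1 z.1.1 - F0 z.1.1) * (F1 z.1.2 - F0 z.1.2)]

end Model

section Contrasts

/-! Empirical quantities, as functions of the observed trajectory `z` (of which only the first `n`
terms are used). -/

variable {E : Set ℝ}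

/-- First order empirical cdf. -/
def empCdf1 (z : ℕ → E) (n : ℕ) (x : E) : ℝ :=
  (1 / (n : ℝ)) * ∑ i ∈ Finset.range n, (Set.Iic x).indicator (fun _ => (1 : ℝ)) (z i)

/-- Second order empirical cdf (used for `n ≥ 2`). -/
def empCdf2 (z : ℕ → E) (n : ℕ) (x y : E) : ℝ :=
  (1 / ((n : ℝ) - 1)) * ∑ i ∈ Finset.range (n - 1),
    (Set.Iic x ×ˢ Set.Iic y).indicator (fun _ => (1 : ℝ)) (z i, z (i + 1))

/-- Plug-in inversion estimator of the unknown cdf under the parameter `θ`. -/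
def empF1 (F0 : E → ℝ) (z : ℕ → E) (n : ℕ) (θ : ℝ × ℝ) (x : E) : ℝ :=
  (1 / rOf θ) * (empCdf1 z n x - pOf θ * F0 x)

/-- The empirical deviation `Δ_n(θ, x, y)`. -/
def empDev (F0 : E → ℝ) (G0 : E → E → ℝ) (z : ℕ → E) (n : ℕ) (θ : ℝ × ℝ) (x y : E) : ℝ :=
  empCdf2 z n x y -
    (lam1 θ * G0 x y + lam2 θ * (F0 x * empF1 F0 z n θ y) + lam3 θ * (empF1 F0 z n θ x * F0 y)
      + lam4 θ * (empF1 F0 z n θ x * empF1 F0 z n θ y))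

/-- The integrated squared contrast `d_n(θ)`. -/
def empD (H : Measure (E × E)) (F0 : E → ℝ) (G0 : E → E → ℝ) (z : ℕ → E) (n : ℕ)
    (θ : ℝ × ℝ) : ℝ :=
  ∫ w, (empDev F0 G0 z n θ w.1 w.2) ^ 2 ∂H

/-- The sup contrast `s_n(θ)`. -/
def empS (F0 : E → ℝ) (G0 : E → E → ℝ) (z : ℕ → E) (n : ℕ) (θ : ℝ × ℝ) : ℝ :=
  ⨆ w : E × E, |empDev F0 G0 z n θ w.1 w.2|

/-- The set of minimizers of `f` over `K`. -/
def argminOn (f : ℝ × ℝ → ℝ) (K : Set (ℝ × ℝ)) : Set (ℝ × ℝ) := {t ∈ K | ∀ u ∈ K, f t ≤ f u}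

end Contrasts

end Poisoning

end

/-!
The observed process is a function of the joint process `(X, Y⁰, Y¹)`. An irreducible two-state chain
whose second eigenvalue has modulus less than `1` is mixing, an i.i.d. sequence is mixing, and `Y⁰` is
mixing by assumption; by independence the joint law is a product, and products of mixing shifts are
mixing (`MixingMap.prod`), hence ergodic. The pointwise ergodic theorem (`ae_tendsto_birkhoffAverage`)
then gives almost sure convergence of the frequencies of pairs of consecutive observations, and a
finite bracketing argument makes it uniform over quadrants (`ae_tendstoUniformly_of_monotone`): the
empirical cdfs of first and second order converge uniformly to `F = p F⁰ + r F¹` and to the mixture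
`G = λ₁ G⁰ + λ₂ F⁰ ⊗ F¹ + λ₃ F¹ ⊗ F⁰ + λ₄ F¹ ⊗ F¹` taken at the true parameter `θ*`.

The deviation depends on the cdfs in a Lipschitz way, uniformly over the parameter space, so both
contrasts converge uniformly on the compact set `Θ` to continuous limits. The limit deviation is
`(λ₁* - λ₁) (G⁰ - F⁰ ⊗ F⁰) + (λ₄* - λ₄ (r* / r)²) (F¹ - F⁰) ⊗ (F¹ - F⁰)`
(`deviation_eq_of_mixture`). It is zero at `θ*`; conversely, if it vanishes `H`-almost everywhere then
linear independence gives `λ₁ = λ₁*` and `λ₄ / r² = λ₄* / r*²`, and these two quantities determine the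
parameter (`eq_of_lam1_eq_of_lam4_div_eq`). Hence `θ*` is the unique minimizer of the limit contrasts,
and minimizers of the empirical contrasts converge to it (`tendsto_of_argmin`). The argument is run
once for functionals of the deviation with the properties `IsContrast`, shared by the mean square and
the supremum.
-/

noncomputable section

namespace Poisoning

/-! ### Mixing transformations -/

section Mixing

variable {α β : Type*} [mα : MeasurableSpace α] [mβ : MeasurableSpace β]

/-- A measure-preserving transformation that is (strongly) mixing. -/
structure MixingMap (T : α → α) (μ : Measure α) : Prop extends MeasurePreserving T μ μ where
  tendsto_inter : ∀ A B : Set α, MeasurableSet A → MeasurableSet B →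
    Tendsto (fun k : ℕ => μ.real (A ∩ T^[k] ⁻¹' B)) atTop (𝓝 (μ.real A * μ.real B))

variable {T : α → α} {μ : Measure α} [IsProbabilityMeasure μ]

/-- Convergence of measures of disjoint unions, by dominated convergence for series. -/
lemma tendsto_iUnion_of_le {s : ℕ → ℕ → Set α} {b c : ℕ → ℝ}
    (hs : ∀ k i, MeasurableSet (s k i)) (hd : ∀ k, Pairwise (Function.onFun Disjoint (s k)))
    (hb : Summable b) (hle : ∀ k i, μ.real (s k i) ≤ b i)
    (h : ∀ i, Tendsto (fun k => μ.real (s k i)) atTop (𝓝 (c i))) :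
    Tendsto (fun k => μ.real (⋃ i, s k i)) atTop (𝓝 (∑' i, c i)) := by
  have e : ∀ k, μ.real (⋃ i, s k i) = ∑' i, μ.real (s k i) := fun k => by
    rw [measureReal_def, measure_iUnion (hd k) (hs k), ENNReal.tsum_toReal_eq]
    · rfl
    · exact fun i => measure_ne_top _ _
  simp_rw [e]
  refine tendsto_tsum_of_dominated_convergence hb h (Eventually.of_forall fun k i => ?_)
  rw [Real.norm_of_nonneg measureReal_nonneg]
  exact hle k i

lemma hasSum_measureReal_iUnion {f : ℕ → Set α} (hd : Pairwise (Function.onFun Disjoint f))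
    (hm : ∀ i, MeasurableSet (f i)) : HasSum (fun i => μ.real (f i)) (μ.real (⋃ i, f i)) := by
  have h1 : ∑' i, μ (f i) = μ (⋃ i, f i) := (measure_iUnion hd hm).symm
  have h2 : ∑' i, μ (f i) ≠ ⊤ := by rw [h1]; exact measure_ne_top _ _
  have := ENNReal.hasSum_toReal h2
  rwa [← ENNReal.tsum_toReal_eq (fun i => measure_ne_top _ _), h1] at this

/-- Mixing may be checked on a generating `π`-system: for each of the two events in turn, the events
satisfying the mixing limit form a Dynkin system, where countable disjoint unions are handled by
dominated convergence thanks to the invariance of the measure. -/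
lemma MixingMap.of_piSystem (hT : MeasurePreserving T μ μ) {C : Set (Set α)}
    (hgen : mα = MeasurableSpace.generateFrom C) (hpi : IsPiSystem C)
    (h : ∀ A ∈ C, ∀ B ∈ C, Tendsto (fun k : ℕ => μ.real (A ∩ T^[k] ⁻¹' B)) atTop
      (𝓝 (μ.real A * μ.real B))) : MixingMap T μ := by
  have hCm : ∀ A ∈ C, MeasurableSet A := fun A hA => by
    rw [hgen]; exact MeasurableSpace.measurableSet_generateFrom hA
  have hpre : ∀ (k : ℕ) {B : Set α}, MeasurableSet B → MeasurableSet (T^[k] ⁻¹' B) :=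
    fun k B hB => (hT.measurable.iterate k) hB
  have hpm : ∀ (k : ℕ) {B : Set α}, MeasurableSet B → μ.real (T^[k] ⁻¹' B) = μ.real B :=
    fun k B hB => by
      rw [measureReal_def, (hT.iterate k).measure_preimage hB.nullMeasurableSet, measureReal_def]
  -- the first event is general, the second one is in the `π`-system
  have h1 : ∀ A, MeasurableSet A → ∀ B ∈ C, Tendsto (fun k : ℕ => μ.real (A ∩ T^[k] ⁻¹' B)) atTop
      (𝓝 (μ.real A * μ.real B)) := by
    intro A hA B hB
    induction A, hA using MeasurableSpace.induction_on_inter hgen hpi with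
    | empty => simp
    | basic A hA => exact h A hA B hB
    | compl A hA ih =>
      have e : ∀ k : ℕ, μ.real (Aᶜ ∩ T^[k] ⁻¹' B) = μ.real B - μ.real (A ∩ T^[k] ⁻¹' B) :=
        fun k => by
          have := measureReal_inter_add_sdiff (μ := μ) (s := T^[k] ⁻¹' B) hA
          rw [Set.sdiff_eq, hpm k (hCm B hB), Set.inter_comm, Set.inter_comm _ Aᶜ] at this
          linarith
      simp_rw [e]
      rw [probReal_compl_eq_one_sub hA, sub_mul, one_mul]
      exact ih.const_sub _
    | iUnion f hd hm ih =>
      simp_rw [Set.iUnion_inter]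
      rw [← (hasSum_measureReal_iUnion hd hm).tsum_eq, ← tsum_mul_right]
      refine tendsto_iUnion_of_le (fun k i => (hm i).inter (hpre k (hCm B hB)))
        (fun k i j hij => ?_) (hasSum_measureReal_iUnion hd hm).summable
        (fun k i => measureReal_mono Set.inter_subset_left) ih
      exact (hd hij).mono Set.inter_subset_left Set.inter_subset_left
  refine ⟨hT, fun A B hA hB => ?_⟩
  induction B, hB using MeasurableSpace.induction_on_inter hgen hpi with
  | empty => simp
  | basic B hB => exact h1 A hA B hB
  | compl B hB ih =>
    have e : ∀ k : ℕ, μ.real (A ∩ T^[k] ⁻¹' Bᶜ) = μ.real A - μ.real (A ∩ T^[k] ⁻¹' B) :=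
      fun k => by
        have := measureReal_inter_add_sdiff (μ := μ) (s := A) (hpre k hB)
        rw [Set.sdiff_eq] at this
        rw [Set.preimage_compl]
        linarith
    simp_rw [e]
    rw [probReal_compl_eq_one_sub hB, mul_sub, mul_one]
    exact ih.const_sub _
  | iUnion f hd hm ih =>
    simp_rw [Set.preimage_iUnion, Set.inter_iUnion]
    rw [← (hasSum_measureReal_iUnion hd hm).tsum_eq, ← tsum_mul_left]
    refine tendsto_iUnion_of_le (fun k i => hA.inter (hpre k (hm i)))
      (fun k i j hij => ?_) (hasSum_measureReal_iUnion hd hm).summable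
      (fun k i => (measureReal_mono Set.inter_subset_right).trans_eq (hpm k (hm i))) ih
    exact ((hd hij).preimage _).mono Set.inter_subset_right Set.inter_subset_right

lemma MixingMap.ergodic (h : MixingMap T μ) : Ergodic T μ := by
  refine ⟨h.toMeasurePreserving, ⟨fun s hs hinv => ?_⟩⟩
  have hk : ∀ k : ℕ, T^[k] ⁻¹' s = s := fun k => Function.IsFixedPt.preimage_iterate hinv k
  have h1 := h.tendsto_inter s s hs hs
  simp_rw [hk, Set.inter_self] at h1
  have h2 : μ.real s = μ.real s * μ.real s := tendsto_nhds_unique tendsto_const_nhds h1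
  have h3 : μ.real s = 0 ∨ μ.real s = 1 := by
    rcases eq_or_ne (μ.real s) 0 with h0 | h0
    · exact Or.inl h0
    · exact Or.inr (mul_left_cancel₀ h0 (by linarith))
  rw [eventuallyConst_set']
  rcases h3 with h3 | h3
  · left
    rw [measureReal_eq_zero_iff] at h3
    exact ae_eq_empty.2 h3
  · right
    rw [ae_eq_univ, ← measureReal_eq_zero_iff, probReal_compl_eq_one_sub hs, h3, sub_self]

/-- Products of mixing transformations are mixing; this fails for mere ergodicity, which is why
mixing is carried along for the three processes. -/
lemma MixingMap.prod {S : β → β} {ν : Measure β} [IsProbabilityMeasure ν]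
    (hT : MixingMap T μ) (hS : MixingMap S ν) : MixingMap (Prod.map T S) (μ.prod ν) := by
  refine MixingMap.of_piSystem (hT.toMeasurePreserving.prod hS.toMeasurePreserving)
    generateFrom_prod.symm isPiSystem_prod ?_
  rintro _ ⟨A, hA, A', hA', rfl⟩ _ ⟨B, hB, B', hB', rfl⟩
  have e : ∀ k : ℕ, (μ.prod ν).real (A ×ˢ A' ∩ (Prod.map T S)^[k] ⁻¹' B ×ˢ B') =
      μ.real (A ∩ T^[k] ⁻¹' B) * ν.real (A' ∩ S^[k] ⁻¹' B') := fun k => by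
    rw [Prod.map_iterate, Set.preimage_prod_map_prod, Set.prod_inter_prod, measureReal_prod_prod]
  simp_rw [e, measureReal_prod_prod]
  have := (hT.tendsto_inter A B hA hB).mul (hS.tendsto_inter A' B' hA' hB')
  convert this using 2
  ring

end Mixing

/-! ### The pointwise ergodic theorem -/

section Birkhoff

variable {α : Type*}

/-- The running maximum `max_{1 ≤ k ≤ n + 1} ∑_{i < k} f ∘ T^i` of the Birkhoff sums, through the
recursion that it satisfies. -/
def maxBirkhoff (T : α → α) (f : α → ℝ) : ℕ → α → ℝ
  | 0 => f
  | n + 1 => fun x => f x + max 0 (maxBirkhoff T f n (T x))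

lemma maxBirkhoff_le_succ (T : α → α) (f : α → ℝ) (n : ℕ) (x : α) :
    maxBirkhoff T f n x ≤ maxBirkhoff T f (n + 1) x := by
  induction n generalizing x with
  | zero => exact le_add_of_nonneg_right (le_max_left _ _)
  | succ n ih =>
    have := ih (T x)
    change f x + max 0 _ ≤ f x + max 0 _
    gcongr

lemma monotone_maxBirkhoff (T : α → α) (f : α → ℝ) (x : α) :
    Monotone fun n => maxBirkhoff T f n x :=
  monotone_nat_of_le_succ fun n => maxBirkhoff_le_succ T f n x

lemma birkhoffSum_succ_le_maxBirkhoff (T : α → α) (f : α → ℝ) (n : ℕ) (x : α) :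
    birkhoffSum T f (n + 1) x ≤ maxBirkhoff T f n x := by
  induction n generalizing x with
  | zero => simp [maxBirkhoff]
  | succ n ih =>
    rw [birkhoffSum_succ']
    exact add_le_add_right ((ih (T x)).trans (le_max_right _ _)) _

variable [MeasurableSpace α] {T : α → α} {μ : Measure α} {f : α → ℝ}

lemma measurable_maxBirkhoff (hT : Measurable T) (hf : Measurable f) (n : ℕ) :
    Measurable (maxBirkhoff T f n) := by
  induction n with
  | zero => exact hf
  | succ n ih => exact hf.add (measurable_const.max (ih.comp hT))

lemma integrable_maxBirkhoff (hT : MeasurePreserving T μ μ) (hf : Integrable f μ) (n : ℕ) :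
    Integrable (maxBirkhoff T f n) μ := by
  induction n with
  | zero => exact hf
  | succ n ih => exact hf.add ((integrable_zero _ _ _).sup (hT.integrable_comp_of_integrable ih))

/-- If `∫ f < 0`, the Birkhoff sums are almost surely bounded above. Otherwise, by ergodicity, the
running maxima `M n` tend to `∞` almost everywhere, so that `M (n + 1) - M n ∘ T` tends to `f`, while
its integral is nonnegative because `M` is monotone and `T` preserves the measure. -/
lemma ae_bddAbove_birkhoffSum (hT : Ergodic T μ) (hfm : Measurable f) (hf : Integrable f μ)
    (hneg : ∫ x, f x ∂μ < 0) :
    ∀ᵐ x ∂μ, BddAbove (Set.range fun n => birkhoffSum T f n x) := by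
  have hTm := hT.toMeasurePreserving
  have hSm : ∀ n, Measurable (birkhoffSum T f n) := fun n => by
    unfold birkhoffSum
    exact Finset.measurable_sum _ fun i _ => hfm.comp (hTm.measurable.iterate i)
  have hBm : MeasurableSet {x | BddAbove (Set.range fun n => birkhoffSum T f n x)} :=
    measurableSet_bddAbove_range hSm
  have hinv : T ⁻¹' {x | BddAbove (Set.range fun n => birkhoffSum T f n x)} =
      {x | BddAbove (Set.range fun n => birkhoffSum T f n x)} := by
    ext x
    simp only [Set.mem_preimage, Set.mem_ofPred_eq, bddAbove_def, Set.forall_mem_range]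
    constructor
    · rintro ⟨c, hc⟩
      refine ⟨max 0 (f x + c), fun n => ?_⟩
      cases n with
      | zero => simp
      | succ n =>
        rw [birkhoffSum_succ']
        exact le_max_of_le_right (add_le_add_right (hc n) _)
    · rintro ⟨c, hc⟩
      refine ⟨c - f x, fun n => ?_⟩
      have := hc (n + 1)
      rw [birkhoffSum_succ'] at this
      linarith
  rcases hT.toPreErgodic.ae_mem_or_ae_notMem hBm hinv with h | h
  · exact h
  exfalso
  have hMi := integrable_maxBirkhoff hTm hf
  -- if the sums are unbounded almost everywhere, then `M (n + 1) - M n ∘ T` decreases to `f`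
  have hlim : Tendsto (fun n => ∫ x, (maxBirkhoff T f (n + 1) x - maxBirkhoff T f n (T x)) ∂μ)
      atTop (𝓝 (∫ x, f x ∂μ)) := by
    refine tendsto_integral_of_dominated_convergence (fun x => |f x| + |f (T x)|) (fun n => ?_)
      (hf.abs.add (hTm.integrable_comp_of_integrable hf).abs) (fun n => ?_) ?_
    · exact ((measurable_maxBirkhoff hTm.measurable hfm _).sub
        ((measurable_maxBirkhoff hTm.measurable hfm n).comp hTm.measurable)).aestronglyMeasurable
    · refine Eventually.of_forall fun x => ?_
      have h0 : f (T x) ≤ maxBirkhoff T f n (T x) := monotone_maxBirkhoff T f (T x) (Nat.zero_le n)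
      have h1 := neg_abs_le (f (T x))
      have h2 := neg_abs_le (f x)
      have h3 := le_abs_self (f x)
      have h4 := abs_nonneg (f (T x))
      change |f x + max 0 (maxBirkhoff T f n (T x)) - maxBirkhoff T f n (T x)| ≤ _
      rcases le_total 0 (maxBirkhoff T f n (T x)) with h5 | h5
      · rw [max_eq_right h5, abs_le]; constructor <;> linarith
      · rw [max_eq_left h5, abs_le]; constructor <;> linarith
    · filter_upwards [h] with x hx
      have hx' : ¬ BddAbove (Set.range fun n => birkhoffSum T f n (T x)) := fun hb =>
        hx (hinv.subset hb)
      obtain ⟨n, hn⟩ : ∃ n, 0 < birkhoffSum T f n (T x) := by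
        by_contra! hcon
        exact hx' ⟨0, by rintro _ ⟨n, rfl⟩; exact hcon n⟩
      obtain ⟨m, rfl⟩ : ∃ m, n = m + 1 :=
        Nat.exists_eq_succ_of_ne_zero (by rintro rfl; simp at hn)
      refine tendsto_const_nhds.congr' ?_
      filter_upwards [eventually_ge_atTop m] with k hk
      have : 0 ≤ maxBirkhoff T f k (T x) :=
        (hn.le.trans (birkhoffSum_succ_le_maxBirkhoff T f m (T x))).trans
          (monotone_maxBirkhoff T f (T x) hk)
      change f x = f x + max 0 (maxBirkhoff T f k (T x)) - maxBirkhoff T f k (T x)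
      rw [max_eq_right this]
      ring
  have hnn : ∀ n, 0 ≤ ∫ x, (maxBirkhoff T f (n + 1) x - maxBirkhoff T f n (T x)) ∂μ := fun n => by
    have e : ∫ x, maxBirkhoff T f n (T x) ∂μ = ∫ x, maxBirkhoff T f n x ∂μ := by
      conv_rhs => rw [← hTm.map_eq]
      rw [integral_map hTm.aemeasurable]
      exact (measurable_maxBirkhoff hTm.measurable hfm n).aestronglyMeasurable
    have hi : Integrable (fun x => maxBirkhoff T f n (T x)) μ :=
      hTm.integrable_comp_of_integrable (hMi n)
    rw [integral_sub (hMi _) hi, e, sub_nonneg]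
    exact integral_mono (hMi _) (hMi _) (maxBirkhoff_le_succ T f n)
  exact absurd (ge_of_tendsto' hlim hnn) (not_le.2 hneg)

variable [IsProbabilityMeasure μ]

lemma ae_eventually_birkhoffAverage_le (hT : Ergodic T μ) (hfm : Measurable f)
    (hf : Integrable f μ) {ε : ℝ} (hε : 0 < ε) :
    ∀ᵐ x ∂μ, ∀ᶠ n in atTop, birkhoffAverage ℝ T f n x ≤ ∫ x, f x ∂μ + ε := by
  -- centred at `c`, the integrand has negative mean, so its Birkhoff sums are bounded above
  set c : ℝ := ∫ x, f x ∂μ + ε / 2 with hc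
  have hneg : ∫ x, (f x - c) ∂μ < 0 := by
    rw [integral_sub hf (integrable_const _)]
    simp [hc]
    linarith
  filter_upwards [ae_bddAbove_birkhoffSum (f := fun x => f x - c) hT (hfm.sub_const c)
    (hf.sub (integrable_const c)) hneg] with x hx
  obtain ⟨C, hC⟩ := hx
  have hC : ∀ n : ℕ, birkhoffSum T f n x ≤ C + n * c := fun n => by
    have := hC ⟨n, rfl⟩
    simp only [birkhoffSum, Finset.sum_sub_distrib, Finset.sum_const, Finset.card_range,
      nsmul_eq_mul] at this ⊢
    linarith
  have hlim : Tendsto (fun n : ℕ => C / (n : ℝ)) atTop (𝓝 0) :=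
    tendsto_const_div_atTop_nhds_zero_nat C
  filter_upwards [hlim.eventually (gt_mem_nhds (half_pos hε)), eventually_gt_atTop 0] with n hn hn0
  have hn' : (0 : ℝ) < n := Nat.cast_pos.2 hn0
  rw [birkhoffAverage, smul_eq_mul, inv_mul_le_iff₀ hn']
  rw [div_lt_iff₀ hn'] at hn
  have := hC n
  rw [hc] at this
  nlinarith

/-- Birkhoff's pointwise ergodic theorem for an ergodic transformation. -/
theorem ae_tendsto_birkhoffAverage (hT : Ergodic T μ) (hfm : Measurable f) (hf : Integrable f μ) :
    ∀ᵐ x ∂μ, Tendsto (fun n => birkhoffAverage ℝ T f n x) atTop (𝓝 (∫ x, f x ∂μ)) := by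
  have hpos : ∀ m : ℕ, (0 : ℝ) < 1 / ((m : ℝ) + 1) := fun m => Nat.one_div_pos_of_nat
  have h1 := ae_all_iff.2 fun m : ℕ => ae_eventually_birkhoffAverage_le hT hfm hf (hpos m)
  have h2 := ae_all_iff.2 fun m : ℕ =>
    ae_eventually_birkhoffAverage_le (f := -f) hT hfm.neg hf.neg (hpos m)
  filter_upwards [h1, h2] with x hx1 hx2
  rw [Metric.tendsto_atTop']
  intro ε hε
  obtain ⟨m, hm⟩ := exists_nat_one_div_lt hε
  obtain ⟨N, hN⟩ := eventually_atTop.1 ((hx1 m).and (hx2 m))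
  refine ⟨N, fun n hn => ?_⟩
  obtain ⟨h3, h4⟩ := hN n hn.le
  rw [birkhoffAverage_neg] at h4
  simp only [Pi.neg_apply, integral_neg] at h4
  rw [Real.dist_eq, abs_lt]
  constructor <;> linarith

end Birkhoff

/-! ### The shift on trajectories -/

section Shift

variable {S : Type*}

/-- The time shift on trajectories. -/
def shift (x : ℕ → S) : ℕ → S := fun i => x (i + 1)

lemma shift_iterate_apply (k : ℕ) (x : ℕ → S) (i : ℕ) : shift^[k] x i = x (i + k) := by
  induction k generalizing x with
  | zero => rfl
  | succ k ih =>
    rw [Function.iterate_succ_apply, ih]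
    change x (i + k + 1) = _
    rw [add_assoc]

variable [MeasurableSpace S]

lemma measurable_shift : Measurable (shift : (ℕ → S) → ℕ → S) :=
  measurable_pi_lambda _ fun i => measurable_pi_apply (i + 1)

variable {Ω : Type*} [MeasurableSpace Ω] {P : Measure Ω}

lemma mixingMap_shift_of_process {Y : ℕ → Ω → S} (hm : ∀ i, Measurable (Y i))
    (hs : IsStationaryProcess P Y) (hmix : IsMixingProcess P Y) :
    MixingMap shift (P.map fun ω (i : ℕ) => Y i ω) := by
  have hY : Measurable fun ω (i : ℕ) => Y i ω := measurable_pi_lambda _ hm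
  refine ⟨⟨measurable_shift, ?_⟩, fun A B hA hB => ?_⟩
  · rw [Measure.map_map measurable_shift hY]
    exact hs
  · rw [map_measureReal_apply hY hA, map_measureReal_apply hY hB]
    refine (hmix A B hA hB).congr fun k => ?_
    rw [map_measureReal_apply hY (hA.inter (measurable_shift.iterate k hB))]
    congr 1
    ext ω
    have : shift^[k] (fun i => Y i ω) = fun i => Y (i + k) ω :=
      funext fun i => shift_iterate_apply k _ i
    simp only [Set.mem_preimage, Set.mem_inter_iff, Set.mem_ofPred_eq, this]

lemma pi_eq_generateFrom {C : Set (Set (ℕ → S))} (hC : ∀ A ∈ C, MeasurableSet A)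
    (h : ∀ (i : ℕ) (B : Set S), MeasurableSet B →
      MeasurableSet[MeasurableSpace.generateFrom C] ((fun x : ℕ → S => x i) ⁻¹' B)) :
    (MeasurableSpace.pi : MeasurableSpace (ℕ → S)) = MeasurableSpace.generateFrom C := by
  refine le_antisymm (iSup_le fun i => ?_) (MeasurableSpace.generateFrom_le hC)
  rintro _ ⟨B, hB, rfl⟩
  exact h i B hB

end Shift

/-! ### Mixing of two-state Markov chains -/

section MarkovChain

/-- The trajectories that start with `s 0, …, s n`. -/
def cylinder (n : ℕ) (s : ℕ → Fin 2) : Set (ℕ → Fin 2) := {x | ∀ i ≤ n, x i = s i}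

lemma measurableSet_cylinder (n : ℕ) (s : ℕ → Fin 2) : MeasurableSet (cylinder n s) := by
  have : cylinder n s = ⋂ i ∈ Set.Iic n, (fun x : ℕ → Fin 2 => x i) ⁻¹' {s i} := by
    ext x; simp [cylinder]
  rw [this]
  exact MeasurableSet.biInter (Set.to_countable _)
    fun i _ => measurable_pi_apply i (measurableSet_singleton _)

/-- The events fixing an initial segment of the trajectory. -/
def cylinders : Set (Set (ℕ → Fin 2)) := {A | ∃ n s, A = cylinder n s}

lemma isPiSystem_cylinders : IsPiSystem cylinders := by
  rintro _ ⟨n, s, rfl⟩ _ ⟨m, t, rfl⟩ ⟨x, hx, hy⟩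
  refine ⟨max n m, x, ?_⟩
  ext y
  simp only [cylinder, Set.mem_inter_iff, Set.mem_ofPred_eq] at hx hy ⊢
  constructor
  · rintro ⟨h1, h2⟩ i hi
    rcases le_max_iff.1 hi with hi | hi
    · rw [h1 i hi, hx i hi]
    · rw [h2 i hi, hy i hi]
  · intro h
    exact ⟨fun i hi => (h i (hi.trans (le_max_left _ _))).trans (hx i hi),
      fun i hi => (h i (hi.trans (le_max_right _ _))).trans (hy i hi)⟩

lemma pi_eq_generateFrom_cylinders :
    (MeasurableSpace.pi : MeasurableSpace (ℕ → Fin 2)) =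
      MeasurableSpace.generateFrom cylinders := by
  refine pi_eq_generateFrom (by rintro _ ⟨n, s, rfl⟩; exact measurableSet_cylinder n s) ?_
  intro i B _
  -- the coordinate event is a finite union of cylinders, one for each admissible prefix
  have : (fun x : ℕ → Fin 2 => x i) ⁻¹' B =
      ⋃ (s : Fin (i + 1) → Fin 2) (_ : s (Fin.last i) ∈ B),
        cylinder i (fun j => if h : j < i + 1 then s ⟨j, h⟩ else 0) := by
    ext x
    simp only [Set.mem_preimage, Set.mem_iUnion, cylinder, Set.mem_ofPred_eq, exists_prop]
    constructor
    · intro hx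
      refine ⟨fun j => x j, hx, fun j hj => ?_⟩
      rw [dif_pos (Nat.lt_succ_of_le hj)]
    · rintro ⟨s, hs, hx⟩
      rw [hx i le_rfl, dif_pos (Nat.lt_succ_self i)]
      exact hs
  rw [this]
  exact MeasurableSet.iUnion fun s => MeasurableSet.iUnion fun _ =>
    MeasurableSpace.measurableSet_generateFrom ⟨_, _, rfl⟩

variable {ν : Measure (ℕ → Fin 2)} [IsProbabilityMeasure ν] {π : Fin 2 → ℝ}
  {Q : Matrix (Fin 2) (Fin 2) ℝ}

lemma measureReal_eq_sum_inter (A : Set (ℕ → Fin 2)) (i : ℕ) :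
    ν.real A = ν.real (A ∩ {x | x i = 0}) + ν.real (A ∩ {x | x i = 1}) := by
  have hm : MeasurableSet {x : ℕ → Fin 2 | x i = 0} :=
    measurable_pi_apply i (measurableSet_singleton 0)
  have he : A \ {x : ℕ → Fin 2 | x i = 0} = A ∩ {x | x i = 1} := by
    ext x
    have : x i = 0 ∨ x i = 1 := by generalize x i = a; fin_cases a <;> simp
    simp only [Set.mem_sdiff, Set.mem_inter_iff, Set.mem_ofPred_eq]
    rcases this with h | h <;> simp [h]
  rw [← measureReal_inter_add_sdiff (μ := ν) (s := A) hm, he]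

/-- The probability of an initial segment `s` of length `n + 1` followed, `k` steps after its end,
by the segment `t`: the Chapman–Kolmogorov formula. -/
lemma measureReal_cylinder_inter (hν : ∀ n s, ν.real (cylinder n s) =
      π (s 0) * ∏ i ∈ Finset.range n, Q (s i) (s (i + 1)))
    (m : ℕ) (t : ℕ → Fin 2) (k n : ℕ) (s : ℕ → Fin 2) :
    ν.real (cylinder n s ∩ shift^[n + k] ⁻¹' cylinder m t) =
      (π (s 0) * ∏ i ∈ Finset.range n, Q (s i) (s (i + 1))) * (Q ^ k) (s n) (t 0) *
        ∏ i ∈ Finset.range m, Q (t i) (t (i + 1)) := by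
  induction k generalizing n s with
  | zero =>
    by_cases hst : s n = t 0
    · set u : ℕ → Fin 2 := fun i => if i ≤ n then s i else t (i - n) with hu
      have hu1 : ∀ i ≤ n, u i = s i := fun i hi => if_pos hi
      have hu2 : ∀ i, u (n + i) = t i := fun i => by
        rcases Nat.eq_zero_or_pos i with rfl | hi
        · rw [add_zero, hu1 n le_rfl, hst]
        · simp only [hu]
          rw [if_neg (by omega), Nat.add_sub_cancel_left]
      have he : cylinder n s ∩ shift^[n + 0] ⁻¹' cylinder m t = cylinder (n + m) u := by
        ext x
        simp only [cylinder, Set.mem_inter_iff, Set.mem_preimage, Set.mem_ofPred_eq,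
          shift_iterate_apply]
        constructor
        · rintro ⟨h1, h2⟩ i hi
          by_cases hin : i ≤ n
          · rw [h1 i hin, hu1 i hin]
          · obtain ⟨j, rfl⟩ := Nat.exists_eq_add_of_le (not_le.1 hin).le
            rw [hu2, ← h2 j (by omega)]
            congr 1
            omega
        · intro h
          refine ⟨fun i hi => by rw [h i (by omega), hu1 i hi], fun i hi => ?_⟩
          rw [← hu2 i, ← h (n + i) (by omega)]
          congr 1
          omega
      rw [he, hν, Finset.prod_range_add, hu1 0 (Nat.zero_le n), pow_zero, hst, Matrix.one_apply_eq,
        mul_one, mul_assoc]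
      congr 2
      · refine Finset.prod_congr rfl fun i hi => ?_
        have := Finset.mem_range.1 hi
        rw [hu1 i (by omega), hu1 (i + 1) (by omega)]
      · refine Finset.prod_congr rfl fun i _ => ?_
        rw [add_assoc, hu2, hu2]
    · have he : cylinder n s ∩ shift^[n + 0] ⁻¹' cylinder m t = ∅ := by
        ext x
        simp only [cylinder, Set.mem_inter_iff, Set.mem_preimage, Set.mem_ofPred_eq,
          shift_iterate_apply, Set.mem_empty_iff_false, iff_false, not_and]
        intro h1 h2
        apply hst
        rw [← h1 n le_rfl, ← h2 0 (Nat.zero_le m)]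
        congr 1
        omega
      rw [he, pow_zero, Matrix.one_apply_ne hst]
      simp
  | succ k ih =>
    have hsplit : ∀ j : Fin 2, cylinder n s ∩ shift^[n + (k + 1)] ⁻¹' cylinder m t ∩
        {x | x (n + 1) = j} = cylinder (n + 1) (Function.update s (n + 1) j) ∩
          shift^[(n + 1) + k] ⁻¹' cylinder m t := fun j => by
      have he : cylinder (n + 1) (Function.update s (n + 1) j) =
          cylinder n s ∩ {x | x (n + 1) = j} := by
        ext x
        simp only [cylinder, Set.mem_inter_iff, Set.mem_ofPred_eq]
        constructor
        · intro h
          refine ⟨fun i hi => ?_, by simpa using h (n + 1) le_rfl⟩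
          rw [h i (by omega), Function.update_of_ne (by omega)]
        · rintro ⟨h1, h2⟩ i hi
          rcases eq_or_ne i (n + 1) with rfl | hne
          · simpa using h2
          · rw [Function.update_of_ne hne, h1 i (by omega)]
      rw [he, show n + (k + 1) = n + 1 + k by omega, Set.inter_right_comm]
    have hprod : ∀ j : Fin 2, ∏ i ∈ Finset.range (n + 1), Q (Function.update s (n + 1) j i)
        (Function.update s (n + 1) j (i + 1)) =
          (∏ i ∈ Finset.range n, Q (s i) (s (i + 1))) * Q (s n) j := fun j => by
      rw [Finset.prod_range_succ, Function.update_of_ne (Nat.succ_ne_self n).symm,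
        Function.update_self]
      congr 1
      refine Finset.prod_congr rfl fun i hi => ?_
      have := Finset.mem_range.1 hi
      rw [Function.update_of_ne (by omega), Function.update_of_ne (by omega)]
    rw [measureReal_eq_sum_inter _ (n + 1), hsplit, hsplit, ih, ih, hprod, hprod, pow_succ',
      Matrix.mul_apply, Fin.sum_univ_two]
    simp only [Function.update_self, Function.update_of_ne (Nat.succ_ne_zero n).symm]
    ring

lemma mixingMap_shift_of_markov (hν : ∀ n s, ν.real (cylinder n s) =
      π (s 0) * ∏ i ∈ Finset.range n, Q (s i) (s (i + 1)))
    (hinv : ∀ b, π 0 * Q 0 b + π 1 * Q 1 b = π b)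
    (hlim : ∀ a b, Tendsto (fun k : ℕ => (Q ^ k) a b) atTop (𝓝 (π b))) :
    MixingMap shift ν := by
  have : IsProbabilityMeasure (ν.map shift) :=
    Measure.isProbabilityMeasure_map measurable_shift.aemeasurable
  have hpres : ν.map shift = ν := by
    refine ext_of_generate_finite cylinders pi_eq_generateFrom_cylinders isPiSystem_cylinders ?_
      (by simp)
    rintro _ ⟨n, s, rfl⟩
    rw [← measureReal_eq_measureReal_iff,
      map_measureReal_apply measurable_shift (measurableSet_cylinder n s),
      measureReal_eq_sum_inter _ 0]
    have he : ∀ j : Fin 2, shift ⁻¹' cylinder n s ∩ {x | x 0 = j} =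
        cylinder (n + 1) (fun i => if i = 0 then j else s (i - 1)) := fun j => by
      ext x
      simp only [cylinder, Set.mem_inter_iff, Set.mem_preimage, Set.mem_ofPred_eq, shift]
      constructor
      · rintro ⟨h1, h2⟩ i hi
        cases i with
        | zero => exact h2
        | succ i => exact h1 i (by omega)
      · intro h
        exact ⟨fun i hi => h (i + 1) (by omega), h 0 (Nat.zero_le _)⟩
    -- adding up over the initial state is the invariance of `π` under `Q`
    rw [he, he, hν, hν, hν, Finset.prod_range_succ', Finset.prod_range_succ', ← hinv (s 0)]
    simp only [Nat.add_sub_cancel, Nat.succ_ne_zero, if_true, if_false, zero_add]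
    ring
  refine MixingMap.of_piSystem ⟨measurable_shift, hpres⟩ pi_eq_generateFrom_cylinders
    isPiSystem_cylinders ?_
  rintro _ ⟨n, s, rfl⟩ _ ⟨m, t, rfl⟩
  rw [hν m t, ← tendsto_add_atTop_iff_nat n]
  have h := ((hlim (s n) (t 0)).const_mul (ν.real (cylinder n s))).mul_const
    (∏ i ∈ Finset.range m, Q (t i) (t (i + 1)))
  rw [mul_assoc] at h
  refine h.congr fun k => ?_
  rw [add_comm k n, measureReal_cylinder_inter hν, hν n s]

/-- Spectral decomposition of the powers of `Π_θ`, whose second eigenvalue is `1 - α - β`. -/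
lemma transMatrix_pow_apply {θ : ℝ × ℝ} (h : θ.1 + θ.2 ≠ 0) (k : ℕ) (a b : Fin 2) :
    (transMatrix θ ^ k) a b = invariantVec θ b +
      (1 - θ.1 - θ.2) ^ k * ((1 : Matrix (Fin 2) (Fin 2) ℝ) a b - invariantVec θ b) := by
  induction k generalizing a with
  | zero => simp
  | succ k ih =>
    rw [pow_succ', Matrix.mul_apply, Fin.sum_univ_two, ih, ih]
    fin_cases a <;> fin_cases b <;>
      simp [transMatrix, invariantVec, pOf, rOf, pow_succ, Matrix.one_apply] <;> field_simp <;> ring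

lemma tendsto_transMatrix_pow {θ : ℝ × ℝ} (h0 : 0 < θ.1 + θ.2) (h2 : θ.1 + θ.2 < 2)
    (a b : Fin 2) :
    Tendsto (fun k : ℕ => (transMatrix θ ^ k) a b) atTop (𝓝 (invariantVec θ b)) := by
  simp_rw [transMatrix_pow_apply h0.ne']
  have := (tendsto_pow_atTop_nhds_zero_of_abs_lt_one (r := 1 - θ.1 - θ.2)
    (abs_lt.2 ⟨by linarith, by linarith⟩)).mul_const
      ((1 : Matrix (Fin 2) (Fin 2) ℝ) a b - invariantVec θ b)
  simpa using this.const_add (invariantVec θ b)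

lemma invariantVec_mul_transMatrix {θ : ℝ × ℝ} (h : θ.1 + θ.2 ≠ 0) (b : Fin 2) :
    invariantVec θ 0 * transMatrix θ 0 b + invariantVec θ 1 * transMatrix θ 1 b =
      invariantVec θ b := by
  fin_cases b <;> simp [transMatrix, invariantVec, pOf, rOf] <;> field_simp <;> ring

end MarkovChain

/-! ### Mixing of i.i.d. sequences -/

section IID

variable {S : Type*} [MeasurableSpace S]

/-- The boxes in the space of trajectories: events restricting the first `n` coordinates
separately. -/
def box (n : ℕ) (s : ℕ → Set S) : Set (ℕ → S) := {x | ∀ i < n, x i ∈ s i}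

lemma measurableSet_box (n : ℕ) {s : ℕ → Set S} (hs : ∀ i, MeasurableSet (s i)) :
    MeasurableSet (box n s) := by
  have : box n s = ⋂ i ∈ Set.Iio n, (fun x : ℕ → S => x i) ⁻¹' s i := by
    ext x; simp [box]
  rw [this]
  exact MeasurableSet.biInter (Set.to_countable _) fun i _ => measurable_pi_apply i (hs i)

/-- The collection of measurable boxes. -/
def boxes (S : Type*) [MeasurableSpace S] : Set (Set (ℕ → S)) :=
  {A | ∃ (n : ℕ) (s : ℕ → Set S), (∀ i, MeasurableSet (s i)) ∧ A = box n s}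

lemma isPiSystem_boxes : IsPiSystem (boxes S) := by
  classical
  rintro _ ⟨n, s, hs, rfl⟩ _ ⟨m, t, ht, rfl⟩ -
  refine ⟨max n m, fun i => (if i < n then s i else Set.univ) ∩ (if i < m then t i else Set.univ),
    fun i => ?_, ?_⟩
  · refine MeasurableSet.inter ?_ ?_ <;> split_ifs <;> simp [hs, ht]
  · ext x
    simp only [box, Set.mem_inter_iff, Set.mem_ofPred_eq]
    constructor
    · rintro ⟨h1, h2⟩ i -
      constructor <;> split_ifs with h <;> simp_all
    · intro h
      refine ⟨fun i hi => ?_, fun i hi => ?_⟩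
      · simpa [hi] using (h i (lt_max_of_lt_left hi)).1
      · simpa [hi] using (h i (lt_max_of_lt_right hi)).2

lemma pi_eq_generateFrom_boxes :
    (MeasurableSpace.pi : MeasurableSpace (ℕ → S)) = MeasurableSpace.generateFrom (boxes S) := by
  classical
  refine pi_eq_generateFrom (by rintro _ ⟨n, s, hs, rfl⟩; exact measurableSet_box n hs) ?_
  intro i B hB
  refine MeasurableSpace.measurableSet_generateFrom
    ⟨i + 1, fun j => if j = i then B else Set.univ, fun j => ?_, ?_⟩
  · dsimp only
    split_ifs <;> simp [hB]
  · ext x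
    simp only [box, Set.mem_preimage, Set.mem_ofPred_eq]
    constructor
    · intro hx j _
      split_ifs with h
      · rwa [h]
      · trivial
    · intro h
      simpa using h i (Nat.lt_succ_self i)

lemma mixingMap_shift_of_box {ν : Measure (ℕ → S)} [IsProbabilityMeasure ν] {m : Set S → ℝ}
    (hm : m Set.univ = 1)
    (hν : ∀ (n : ℕ) (s : ℕ → Set S), (∀ i, MeasurableSet (s i)) →
      ν.real (box n s) = ∏ i ∈ Finset.range n, m (s i)) : MixingMap shift ν := by
  classical
  have : IsProbabilityMeasure (ν.map shift) :=
    Measure.isProbabilityMeasure_map measurable_shift.aemeasurable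
  have hpres : ν.map shift = ν := by
    refine ext_of_generate_finite (boxes S) pi_eq_generateFrom_boxes isPiSystem_boxes ?_ (by simp)
    rintro _ ⟨n, s, hs, rfl⟩
    rw [← measureReal_eq_measureReal_iff,
      map_measureReal_apply measurable_shift (measurableSet_box n hs)]
    have he : shift ⁻¹' box n s = box (n + 1) (fun i => Nat.casesOn i Set.univ s) := by
      ext x
      simp only [box, Set.mem_preimage, Set.mem_ofPred_eq, shift]
      constructor
      · intro h i hi
        cases i with
        | zero => trivial
        | succ i => exact h i (by omega)
      · intro h i hi
        exact h (i + 1) (by omega)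
    rw [he, hν _ _ (fun i => by cases i <;> simp [hs]), hν n s hs, Finset.prod_range_succ']
    simp [hm]
  refine MixingMap.of_piSystem ⟨measurable_shift, hpres⟩ pi_eq_generateFrom_boxes
    isPiSystem_boxes ?_
  rintro _ ⟨n, s, hs, rfl⟩ _ ⟨l, t, ht, rfl⟩
  rw [← tendsto_add_atTop_iff_nat n]
  -- a box and its translate by `n + k` depend on disjoint sets of coordinates
  refine tendsto_const_nhds.congr fun k => ?_
  set u : ℕ → Set S := fun i => if i < n then s i else if i < n + k then Set.univ
    else t (i - (n + k)) with hu
  have hu1 : ∀ i < n, u i = s i := fun i hi => if_pos hi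
  have hu2 : ∀ i < k, u (n + i) = Set.univ := fun i hi => by
    simp only [hu]
    rw [if_neg (by omega), if_pos (by omega)]
  have hu3 : ∀ i, u (n + k + i) = t i := fun i => by
    simp only [hu]
    rw [if_neg (by omega), if_neg (by omega), Nat.add_sub_cancel_left]
  have hum : ∀ i, MeasurableSet (u i) := fun i => by
    simp only [hu]
    split_ifs <;> simp [hs, ht]
  have he : box n s ∩ shift^[k + n] ⁻¹' box l t = box (n + k + l) u := by
    ext x
    simp only [box, Set.mem_inter_iff, Set.mem_preimage, Set.mem_ofPred_eq, shift_iterate_apply]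
    constructor
    · rintro ⟨h1, h2⟩ i hi
      by_cases hin : i < n
      · rw [hu1 i hin]; exact h1 i hin
      by_cases hik : i < n + k
      · obtain ⟨j, rfl⟩ := Nat.exists_eq_add_of_le (not_lt.1 hin)
        rw [hu2 j (by omega)]; trivial
      · obtain ⟨j, rfl⟩ := Nat.exists_eq_add_of_le (not_lt.1 hik)
        rw [hu3, show n + k + j = j + (k + n) by omega]
        exact h2 j (by omega)
    · intro h
      refine ⟨fun i hi => by rw [← hu1 i hi]; exact h i (by omega), fun i hi => ?_⟩
      rw [← hu3 i, show i + (k + n) = n + k + i by omega]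
      exact h _ (by omega)
  have e1 : ∏ i ∈ Finset.range n, m (u i) = ∏ i ∈ Finset.range n, m (s i) :=
    Finset.prod_congr rfl fun i hi => by rw [hu1 i (Finset.mem_range.1 hi)]
  have e2 : ∏ i ∈ Finset.range k, m (u (n + i)) = 1 :=
    Finset.prod_eq_one fun i hi => by rw [hu2 i (Finset.mem_range.1 hi), hm]
  rw [he, hν _ u hum, hν n s hs, hν l t ht, Finset.prod_range_add, Finset.prod_range_add, e1, e2,
    mul_one]
  simp_rw [hu3]

lemma mixingMap_shift_of_iid {Ω : Type*} [MeasurableSpace Ω] {P : Measure Ω}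
    [IsProbabilityMeasure P] {Y : ℕ → Ω → S} (hm : ∀ i, Measurable (Y i))
    (h : IsIIDProcess P Y) : MixingMap shift (P.map fun ω (i : ℕ) => Y i ω) := by
  have hY : Measurable fun ω (i : ℕ) => Y i ω := measurable_pi_lambda _ hm
  have : IsProbabilityMeasure (P.map fun ω (i : ℕ) => Y i ω) :=
    Measure.isProbabilityMeasure_map hY.aemeasurable
  refine mixingMap_shift_of_box (m := fun A => P.real (Y 0 ⁻¹' A)) (by simp) fun n s hs => ?_
  rw [map_measureReal_apply hY (measurableSet_box n hs)]
  have he : (fun ω (i : ℕ) => Y i ω) ⁻¹' box n s = ⋂ i ∈ Finset.range n, Y i ⁻¹' s i := by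
    ext ω; simp [box]
  rw [he, measureReal_def, h.1.measure_inter_preimage_eq_mul _ (fun i _ => hs i),
    ENNReal.toReal_prod]
  refine Finset.prod_congr rfl fun i _ => ?_
  rw [(h.2 i).measure_mem_eq (hs i)]
  rfl

end IID

/-! ### Uniform convergence over lower-left quadrants -/

section GlivenkoCantelli

variable {S : Type*} [MeasurableSpace S] {ν : Measure S}

/-- The sublevel sets of `φ` at the levels in `K` are bracketed by finitely many pairs of measurable
sets whose gaps have `ν`-measure less than `ε`. -/
def HasBrackets (ν : Measure S) (φ : S → EReal) (ε : ℝ) (K : Set EReal) : Prop :=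
  ∃ b : Set (Set S × Set S), b.Finite ∧ (∀ p ∈ b, MeasurableSet p.1 ∧ MeasurableSet p.2) ∧
    ∀ x ∈ K, ∃ p ∈ b, p.1 ⊆ {s | φ s ≤ x} ∧ {s | φ s ≤ x} ⊆ p.2 ∧ ν.real (p.2 \ p.1) < ε

lemma HasBrackets.of_bracket {φ : S → EReal} {ε : ℝ} {K : Set EReal} (L U : Set S)
    (hL : MeasurableSet L) (hU : MeasurableSet U) (hK : ∀ x ∈ K, L ⊆ {s | φ s ≤ x} ∧
      {s | φ s ≤ x} ⊆ U) (h : ν.real (U \ L) < ε) : HasBrackets ν φ ε K :=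
  ⟨{(L, U)}, Set.finite_singleton _, by rintro _ rfl; exact ⟨hL, hU⟩,
    fun x hx => ⟨_, rfl, (hK x hx).1, (hK x hx).2, h⟩⟩

variable [IsProbabilityMeasure ν]

/-- Finite bracketing of the sublevel sets over all levels in `[-∞, ∞]`. By compactness it suffices to
bracket near each level `a`: on the right of `a` between `{φ ≤ a}` and `{φ < v}`, on the left between
`{φ ≤ u}` and `{φ < a}`, and at `a` itself exactly, so that atoms are allowed. -/
lemma hasBrackets_univ {φ : S → EReal} (hφ : Measurable φ) {ε : ℝ} (hε : 0 < ε) :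
    HasBrackets ν φ ε Set.univ := by
  have hε' : (0 : ENNReal) < ENNReal.ofReal ε := ENNReal.ofReal_pos.2 hε
  have hlt : ∀ {A : Set S}, ν A < ENNReal.ofReal ε → ν.real A < ε := fun {A} h => by
    rw [measureReal_def]
    exact (ENNReal.lt_ofReal_iff_toReal_lt (measure_ne_top _ _)).1 h
  have hempty : HasBrackets ν φ ε ∅ := ⟨∅, Set.finite_empty, by simp, by simp⟩
  have hunion : ∀ ⦃s t⦄, HasBrackets ν φ ε s → HasBrackets ν φ ε t →
      HasBrackets ν φ ε (s ∪ t) := by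
    rintro s t ⟨b, hb1, hb2, hb3⟩ ⟨c, hc1, hc2, hc3⟩
    refine ⟨b ∪ c, hb1.union hc1, fun p hp => hp.elim (hb2 p) (hc2 p), fun x hx => ?_⟩
    rcases hx with hx | hx
    · obtain ⟨p, hp, h⟩ := hb3 x hx
      exact ⟨p, Or.inl hp, h⟩
    · obtain ⟨p, hp, h⟩ := hc3 x hx
      exact ⟨p, Or.inr hp, h⟩
  refine isCompact_univ.induction_on hempty ?_ hunion ?_
  · rintro s t hst ⟨b, hb1, hb2, hb3⟩
    exact ⟨b, hb1, hb2, fun x hx => hb3 x (hst hx)⟩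
  · intro a _
    have hright : ∃ t ∈ 𝓝[>] a, HasBrackets ν φ ε t := by
      rcases eq_or_ne a ⊤ with rfl | ha
      · exact ⟨∅, by simp, hempty⟩
      have hmeas : ∀ r, MeasurableSet {s | a < φ s ∧ φ s < r} := fun r =>
        (measurableSet_lt measurable_const hφ).inter (measurableSet_lt hφ measurable_const)
      have hlim := tendsto_measure_biInter_gt (μ := ν) (a := a)
        (s := fun r => {s | a < φ s ∧ φ s < r}) (fun r _ => (hmeas r).nullMeasurableSet)
        (fun i j _ hij s hs => ⟨hs.1, hs.2.trans_le hij⟩) ⟨⊤, ha.lt_top, measure_ne_top _ _⟩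
      have he : ⋂ r > a, {s | a < φ s ∧ φ s < r} = (∅ : Set S) := by
        ext s
        simp only [Set.mem_iInter, Set.mem_ofPred_eq, Set.mem_empty_iff_false, iff_false]
        intro h
        have h1 := (h ⊤ ha.lt_top).1
        exact lt_irrefl _ (h (φ s) h1).2
      rw [he, measure_empty] at hlim
      have : (𝓝[>] a).NeBot := nhdsGT_neBot_of_exists_gt ⟨⊤, ha.lt_top⟩
      obtain ⟨v, hv, hav⟩ := ((hlim.eventually (gt_mem_nhds hε')).and self_mem_nhdsWithin).exists
      refine ⟨Set.Ioo a v, Ioo_mem_nhdsGT hav, HasBrackets.of_bracket {s | φ s ≤ a} {s | φ s < v}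
        (measurableSet_le hφ measurable_const) (measurableSet_lt hφ measurable_const)
        (fun x hx => ⟨fun s hs => le_trans hs hx.1.le, fun s hs => lt_of_le_of_lt hs hx.2⟩)
        (hlt (lt_of_le_of_lt (measure_mono ?_) hv))⟩
      rintro s ⟨h1, h2⟩
      exact ⟨not_le.1 h2, h1⟩
    have hleft : ∃ t ∈ 𝓝[<] a, HasBrackets ν φ ε t := by
      rcases eq_or_ne a ⊥ with rfl | ha
      · exact ⟨∅, by simp, hempty⟩
      have hmeas : ∀ r, MeasurableSet {s | r < φ s ∧ φ s < a} := fun r =>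
        (measurableSet_lt measurable_const hφ).inter (measurableSet_lt hφ measurable_const)
      have hlim := tendsto_measure_biInter_gt (μ := ν) (ι := ERealᵒᵈ) (a := OrderDual.toDual a)
        (s := fun r => {s | OrderDual.ofDual r < φ s ∧ φ s < a})
        (fun r _ => (hmeas _).nullMeasurableSet)
        (fun i j _ hij s hs => ⟨lt_of_le_of_lt hij hs.1, hs.2⟩)
        ⟨OrderDual.toDual ⊥, ha.bot_lt, measure_ne_top _ _⟩
      have he : ⋂ r > OrderDual.toDual a, {s | OrderDual.ofDual r < φ s ∧ φ s < a} =
          (∅ : Set S) := by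
        ext s
        simp only [Set.mem_iInter, Set.mem_ofPred_eq, Set.mem_empty_iff_false, iff_false]
        intro h
        have h1 := (h (OrderDual.toDual ⊥) ha.bot_lt).2
        exact lt_irrefl _ (h (OrderDual.toDual (φ s)) h1).1
      rw [he, measure_empty] at hlim
      have hlim' : Tendsto (fun r : EReal => ν {s | r < φ s ∧ φ s < a}) (𝓝[<] a) (𝓝 0) := hlim
      have : (𝓝[<] a).NeBot := nhdsLT_neBot_of_exists_lt ⟨⊥, ha.bot_lt⟩
      obtain ⟨u, hu, hua⟩ := ((hlim'.eventually (gt_mem_nhds hε')).and self_mem_nhdsWithin).exists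
      refine ⟨Set.Ioo u a, Ioo_mem_nhdsLT hua, HasBrackets.of_bracket {s | φ s ≤ u} {s | φ s < a}
        (measurableSet_le hφ measurable_const) (measurableSet_lt hφ measurable_const)
        (fun x hx => ⟨fun s hs => le_trans hs hx.1.le, fun s hs => lt_of_le_of_lt hs hx.2⟩)
        (hlt (lt_of_le_of_lt (measure_mono ?_) hu))⟩
      rintro s ⟨h1, h2⟩
      exact ⟨not_le.1 h2, h1⟩
    have hpoint : HasBrackets ν φ ε {a} :=
      HasBrackets.of_bracket {s | φ s ≤ a} {s | φ s ≤ a} (measurableSet_le hφ measurable_const)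
        (measurableSet_le hφ measurable_const) (by rintro x rfl; exact ⟨le_rfl, le_rfl⟩)
        (by simpa using hε)
    obtain ⟨t, ht, htb⟩ := hright
    obtain ⟨t', ht', htb'⟩ := hleft
    refine ⟨{a} ∪ (t' ∪ t), ?_, hunion hpoint (hunion htb' htb)⟩
    rw [nhdsWithin_univ, Set.singleton_union, insert_mem_nhds_iff, ← nhdsLT_sup_nhdsGT]
    exact union_mem_sup ht' ht

variable {Ω : Type*} [MeasurableSpace Ω] {P : Measure Ω}

/-- A Glivenko–Cantelli theorem: set functions that are monotone and converge almost surely to `ν` on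
each measurable set do so uniformly over the quadrants `{φ ≤ x, ψ ≤ y}`. Levels are extended reals, so
that one-dimensional half-lines are included. -/
theorem ae_tendstoUniformly_of_monotone {φ ψ : S → EReal} (hφ : Measurable φ) (hψ : Measurable ψ)
    {N : ℕ → Ω → Set S → ℝ} (hmono : ∀ n ω, Monotone (N n ω))
    (hconv : ∀ A, MeasurableSet A →
      ∀ᵐ ω ∂P, Tendsto (fun n => N n ω A) atTop (𝓝 (ν.real A))) :
    ∀ᵐ ω ∂P, TendstoUniformly (fun n (p : EReal × EReal) => N n ω {s | φ s ≤ p.1 ∧ ψ s ≤ p.2})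
      (fun p => ν.real {s | φ s ≤ p.1 ∧ ψ s ≤ p.2}) atTop := by
  have hpos : ∀ m : ℕ, (0 : ℝ) < 1 / ((m : ℝ) + 1) := fun m => Nat.one_div_pos_of_nat
  choose b hbf hbm hb using fun m => hasBrackets_univ (ν := ν) hφ (hpos m)
  choose c hcf hcm hc using fun m => hasBrackets_univ (ν := ν) hψ (hpos m)
  have hae : ∀ᵐ ω ∂P, ∀ m, ∀ p ∈ b m, ∀ q ∈ c m,
      Tendsto (fun n => N n ω (p.1 ∩ q.1)) atTop (𝓝 (ν.real (p.1 ∩ q.1))) ∧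
      Tendsto (fun n => N n ω (p.2 ∩ q.2)) atTop (𝓝 (ν.real (p.2 ∩ q.2))) := by
    refine ae_all_iff.2 fun m => (ae_ball_iff (hbf m).countable).2 fun p hp =>
      (ae_ball_iff (hcf m).countable).2 fun q hq => ?_
    exact (hconv _ ((hbm m p hp).1.inter (hcm m q hq).1)).and
      (hconv _ ((hbm m p hp).2.inter (hcm m q hq).2))
  filter_upwards [hae] with ω hω
  rw [Metric.tendstoUniformly_iff]
  intro ε hε
  obtain ⟨m, hm⟩ := exists_nat_one_div_lt (by positivity : 0 < ε / 3)
  have hev : ∀ᶠ n in atTop, ∀ p ∈ b m, ∀ q ∈ c m,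
      |N n ω (p.1 ∩ q.1) - ν.real (p.1 ∩ q.1)| < ε / 3 ∧
      |N n ω (p.2 ∩ q.2) - ν.real (p.2 ∩ q.2)| < ε / 3 := by
    rw [eventually_all_finite (hbf m)]
    intro p hp
    rw [eventually_all_finite (hcf m)]
    intro q hq
    exact ((Metric.tendsto_nhds.1 (hω m p hp q hq).1) _ (by positivity)).and
      ((Metric.tendsto_nhds.1 (hω m p hp q hq).2) _ (by positivity))
  filter_upwards [hev] with n hn
  rintro ⟨x, y⟩
  obtain ⟨p, hp, hp1, hp2, hp3⟩ := hb m x (Set.mem_univ _)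
  obtain ⟨q, hq, hq1, hq2, hq3⟩ := hc m y (Set.mem_univ _)
  obtain ⟨h1, h2⟩ := hn p hp q hq
  rw [abs_lt] at h1 h2
  have hL : p.1 ∩ q.1 ⊆ {s | φ s ≤ x ∧ ψ s ≤ y} := fun s hs => ⟨hp1 hs.1, hq1 hs.2⟩
  have hU : {s | φ s ≤ x ∧ ψ s ≤ y} ⊆ p.2 ∩ q.2 := fun s hs => ⟨hp2 hs.1, hq2 hs.2⟩
  have hgap : ν.real (p.2 ∩ q.2) ≤
      ν.real (p.1 ∩ q.1) + (ν.real (p.2 \ p.1) + ν.real (q.2 \ q.1)) := by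
    refine (measureReal_mono (s₂ := p.1 ∩ q.1 ∪ (p.2 \ p.1 ∪ q.2 \ q.1)) ?_).trans
      ((measureReal_union_le _ _).trans (add_le_add_right (measureReal_union_le _ _) _))
    rintro s ⟨hs1, hs2⟩
    by_cases h1 : s ∈ p.1
    · by_cases h2 : s ∈ q.1
      · exact Or.inl ⟨h1, h2⟩
      · exact Or.inr (Or.inr ⟨hs2, h2⟩)
    · exact Or.inr (Or.inl ⟨hs1, h1⟩)
  have h3 := hmono n ω hL
  have h4 := hmono n ω hU
  have h5 := measureReal_mono (μ := ν) hL
  have h6 := measureReal_mono (μ := ν) hU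
  rw [Real.dist_eq, abs_lt]
  constructor <;> linarith

end GlivenkoCantelli

/-! ### Ergodicity and pair law of the observed process -/

section Model

variable {Ω : Type*} [MeasurableSpace Ω] {P : Measure Ω} {E : Set ℝ}
  {θ : ℝ × ℝ} {X : ℕ → Ω → Fin 2} {Y0 Y1 : ℕ → Ω → E}

lemma measurable_observed (h : IsPoisoningModel P θ X Y0 Y1) (i : ℕ) :
    Measurable (observed X Y0 Y1 i) :=
  Measurable.ite (h.measurable_X i (measurableSet_singleton 0)) (h.measurable_Y0 i)
    (h.measurable_Y1 i)

/-- The joint trajectory of the three processes. -/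
def jointTrajectory (X : ℕ → Ω → Fin 2) (Y0 Y1 : ℕ → Ω → E) (ω : Ω) :
    (ℕ → Fin 2) × (ℕ → E) × (ℕ → E) :=
  (fun i => X i ω, fun i => Y0 i ω, fun i => Y1 i ω)

/-- The shift on joint trajectories. -/
def jointShift : (ℕ → Fin 2) × (ℕ → E) × (ℕ → E) → (ℕ → Fin 2) × (ℕ → E) × (ℕ → E) :=
  Prod.map shift (Prod.map shift shift)

/-- The first observation, as a function of the joint trajectory. -/
def firstObservation (w : (ℕ → Fin 2) × (ℕ → E) × (ℕ → E)) : E :=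
  if w.1 0 = 0 then w.2.1 0 else w.2.2 0

omit [MeasurableSpace Ω] in
lemma firstObservation_jointShift_iterate (k : ℕ) (ω : Ω) :
    firstObservation (jointShift^[k] (jointTrajectory X Y0 Y1 ω)) = observed X Y0 Y1 k ω := by
  rw [jointShift, Prod.map_iterate, Prod.map_iterate]
  simp [firstObservation, jointTrajectory, shift_iterate_apply, observed]

lemma measurable_firstObservation :
    Measurable (firstObservation : (ℕ → Fin 2) × (ℕ → E) × (ℕ → E) → E) := by
  unfold firstObservation
  refine Measurable.ite ?_ (by fun_prop) (by fun_prop)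
  exact ((measurable_pi_apply 0).comp measurable_fst) (measurableSet_singleton 0)

lemma measurable_jointTrajectory (h : IsPoisoningModel P θ X Y0 Y1) :
    Measurable (jointTrajectory X Y0 Y1) :=
  (measurable_pi_lambda _ h.measurable_X).prodMk
    ((measurable_pi_lambda _ h.measurable_Y0).prodMk (measurable_pi_lambda _ h.measurable_Y1))

lemma measureReal_initial_pair (h : IsPoisoningModel P θ X Y0 Y1) (a b : Fin 2) :
    P.real {ω | X 0 ω = a ∧ X 1 ω = b} = invariantVec θ a * transMatrix θ a b := by
  have := h.markov_X 1 (fun i => if i = 0 then a else b)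
  simp only [Finset.prod_range_one, zero_add, if_true, one_ne_zero, if_false] at this
  rw [← this]
  congr 1
  ext ω
  simp only [Set.mem_ofPred_eq]
  constructor
  · rintro ⟨h1, h2⟩ i hi
    interval_cases i <;> simp [h1, h2]
  · intro h
    exact ⟨by simpa using h 0 zero_le_one, by simpa using h 1 le_rfl⟩

variable [IsProbabilityMeasure P]

lemma mixingMap_jointShift (h : IsPoisoningModel P θ X Y0 Y1) (h0 : 0 < θ.1 + θ.2)
    (h2 : θ.1 + θ.2 < 2) : MixingMap jointShift (P.map (jointTrajectory X Y0 Y1)) := by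
  have mX := measurable_pi_lambda _ h.measurable_X
  have m0 := measurable_pi_lambda _ h.measurable_Y0
  have m1 := measurable_pi_lambda _ h.measurable_Y1
  have pX := Measure.isProbabilityMeasure_map (μ := P) mX.aemeasurable
  have p0 := Measure.isProbabilityMeasure_map (μ := P) m0.aemeasurable
  have p1 := Measure.isProbabilityMeasure_map (μ := P) m1.aemeasurable
  have e : P.map (jointTrajectory X Y0 Y1) = (P.map fun ω i => X i ω).prod
      ((P.map fun ω i => Y0 i ω).prod (P.map fun ω i => Y1 i ω)) := by
    rw [← (indepFun_iff_map_prod_eq_prod_map_map m0.aemeasurable m1.aemeasurable).1 h.indep_Y]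
    exact (indepFun_iff_map_prod_eq_prod_map_map mX.aemeasurable (m0.prodMk m1).aemeasurable).1
      h.indep_X
  rw [e]
  refine MixingMap.prod ?_ (MixingMap.prod
    (mixingMap_shift_of_process h.measurable_Y0 h.stationary_Y0 h.mixing_Y0)
    (mixingMap_shift_of_iid h.measurable_Y1 h.iid_Y1))
  refine mixingMap_shift_of_markov (π := invariantVec θ) (Q := transMatrix θ) (fun n s => ?_)
    (invariantVec_mul_transMatrix h0.ne') (tendsto_transMatrix_pow h0 h2)
  rw [map_measureReal_apply mX (measurableSet_cylinder n s)]
  exact h.markov_X n s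

/-- The relative frequency of `A` among the first `n` pairs of consecutive terms of `z`. -/
def pairFreq (z : ℕ → E) (n : ℕ) (A : Set (E × E)) : ℝ :=
  (n : ℝ)⁻¹ * ∑ i ∈ Finset.range n, A.indicator (fun _ => (1 : ℝ)) (z i, z (i + 1))

lemma monotone_pairFreq (z : ℕ → E) (n : ℕ) : Monotone (pairFreq z n) := fun A B hAB => by
  unfold pairFreq
  gcongr

/-- Strong law of large numbers for the pairs of consecutive observations. -/
lemma ae_tendsto_pairFreq (h : IsPoisoningModel P θ X Y0 Y1) (h0 : 0 < θ.1 + θ.2)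
    (h2 : θ.1 + θ.2 < 2) (A : Set (E × E)) (hA : MeasurableSet A) :
    ∀ᵐ ω ∂P, Tendsto (fun n => pairFreq (fun i => observed X Y0 Y1 i ω) n A) atTop
      (𝓝 ((P.map fun ω => (observed X Y0 Y1 0 ω, observed X Y0 Y1 1 ω)).real A)) := by
  have hW := measurable_jointTrajectory h
  have := Measure.isProbabilityMeasure_map (μ := P) hW.aemeasurable
  have hT := mixingMap_jointShift h h0 h2
  set g : (ℕ → Fin 2) × (ℕ → E) × (ℕ → E) → E × E :=
    fun w => (firstObservation w, firstObservation (jointShift w)) with hg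
  have hgm : Measurable g :=
    measurable_firstObservation.prodMk (measurable_firstObservation.comp hT.measurable)
  have hgk : ∀ k ω, g (jointShift^[k] (jointTrajectory X Y0 Y1 ω)) =
      (observed X Y0 Y1 k ω, observed X Y0 Y1 (k + 1) ω) := fun k ω => by
    simp only [hg]
    rw [← Function.iterate_succ_apply' jointShift, firstObservation_jointShift_iterate,
      firstObservation_jointShift_iterate]
  have hfm : Measurable ((g ⁻¹' A).indicator fun _ => (1 : ℝ)) :=
    measurable_const.indicator (hgm hA)
  have hfi : Integrable ((g ⁻¹' A).indicator fun _ => (1 : ℝ))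
      (P.map (jointTrajectory X Y0 Y1)) := (integrable_const _).indicator (hgm hA)
  have key := ae_of_ae_map hW.aemeasurable (ae_tendsto_birkhoffAverage hT.ergodic hfm hfi)
  have hlim : ∫ w, (g ⁻¹' A).indicator (fun _ => (1 : ℝ)) w ∂(P.map (jointTrajectory X Y0 Y1)) =
      (P.map fun ω => (observed X Y0 Y1 0 ω, observed X Y0 Y1 1 ω)).real A := by
    rw [integral_indicator_const _ (hgm hA), smul_eq_mul, mul_one,
      map_measureReal_apply hW (hgm hA),
      map_measureReal_apply ((measurable_observed h 0).prodMk (measurable_observed h 1)) hA]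
    congr 1
  rw [hlim] at key
  filter_upwards [key] with ω hω
  refine hω.congr fun n => ?_
  rw [birkhoffAverage, birkhoffSum, pairFreq, smul_eq_mul]
  congr 1
  refine Finset.sum_congr rfl fun k _ => ?_
  rw [← hgk k ω]
  rfl

/-- The empirical frequencies of pairs of consecutive observations converge uniformly over quadrants.
The level `⊤` in the second variable gives the first-order cdf. -/
lemma ae_tendstoUniformly_pairFreq (h : IsPoisoningModel P θ X Y0 Y1) (h0 : 0 < θ.1 + θ.2)
    (h2 : θ.1 + θ.2 < 2) :
    ∀ᵐ ω ∂P, TendstoUniformly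
      (fun n (p : EReal × EReal) => pairFreq (fun i => observed X Y0 Y1 i ω) n
        {s | ((s.1 : ℝ) : EReal) ≤ p.1 ∧ ((s.2 : ℝ) : EReal) ≤ p.2})
      (fun p => (P.map fun ω => (observed X Y0 Y1 0 ω, observed X Y0 Y1 1 ω)).real
        {s | ((s.1 : ℝ) : EReal) ≤ p.1 ∧ ((s.2 : ℝ) : EReal) ≤ p.2}) atTop := by
  have := Measure.isProbabilityMeasure_map (μ := P)
    ((measurable_observed h 0).prodMk (measurable_observed h 1)).aemeasurable
  exact ae_tendstoUniformly_of_monotone (φ := fun s : E × E => ((s.1 : ℝ) : EReal))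
    (ψ := fun s : E × E => ((s.2 : ℝ) : EReal))
    (measurable_coe_real_ereal.comp (measurable_subtype_coe.comp measurable_fst))
    (measurable_coe_real_ereal.comp (measurable_subtype_coe.comp measurable_snd))
    (fun n ω => monotone_pairFreq _ n) (ae_tendsto_pairFreq h h0 h2)

/-- The law of two consecutive observations, decomposed along the states of the selection chain. -/
lemma measureReal_observed_pair (h : IsPoisoningModel P θ X Y0 Y1) {A B : Set E}
    (hA : MeasurableSet A) (hB : MeasurableSet B) :
    P.real {ω | observed X Y0 Y1 0 ω ∈ A ∧ observed X Y0 Y1 1 ω ∈ B} =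
      lam1 θ * P.real {ω | Y0 0 ω ∈ A ∧ Y0 1 ω ∈ B} +
      lam2 θ * (P.real {ω | Y0 0 ω ∈ A} * P.real {ω | Y1 0 ω ∈ B}) +
      lam3 θ * (P.real {ω | Y1 0 ω ∈ A} * P.real {ω | Y0 0 ω ∈ B}) +
      lam4 θ * (P.real {ω | Y1 0 ω ∈ A} * P.real {ω | Y1 0 ω ∈ B}) := by
  have m0 : Measurable fun ω i => Y0 i ω := measurable_pi_lambda _ h.measurable_Y0
  have m1 : Measurable fun ω i => Y1 i ω := measurable_pi_lambda _ h.measurable_Y1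
  have hX : ∀ a b : Fin 2, ∀ D : Set ((ℕ → E) × (ℕ → E)), MeasurableSet D →
      P.real {ω | (X 0 ω = a ∧ X 1 ω = b) ∧ ((fun i => Y0 i ω), (fun i => Y1 i ω)) ∈ D} =
        invariantVec θ a * transMatrix θ a b *
          P.real {ω | ((fun i => Y0 i ω), (fun i => Y1 i ω)) ∈ D} := fun a b D hD => by
    rw [← measureReal_initial_pair h]
    have hp : ∀ (i : ℕ) (c : Fin 2), MeasurableSet {x : ℕ → Fin 2 | x i = c} :=
      fun i c => (measurable_pi_apply i : Measurable fun x : ℕ → Fin 2 => x i)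
        (measurableSet_singleton c)
    have hm : MeasurableSet {x : ℕ → Fin 2 | x 0 = a ∧ x 1 = b} := (hp 0 a).inter (hp 1 b)
    have := h.indep_X.measure_inter_preimage_eq_mul _ _ hm hD
    rw [measureReal_def, measureReal_def, measureReal_def, ← ENNReal.toReal_mul]
    exact congrArg ENNReal.toReal this
  have hY : ∀ C D : Set (ℕ → E), MeasurableSet C → MeasurableSet D →
      P.real {ω | (fun i => Y0 i ω) ∈ C ∧ (fun i => Y1 i ω) ∈ D} =
        P.real {ω | (fun i => Y0 i ω) ∈ C} * P.real {ω | (fun i => Y1 i ω) ∈ D} :=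
    fun C D hC hD => by
      have := h.indep_Y.measure_inter_preimage_eq_mul _ _ hC hD
      rw [measureReal_def, measureReal_def, measureReal_def, ← ENNReal.toReal_mul]
      exact congrArg ENNReal.toReal this
  have hev : ∀ (i : ℕ) {C : Set E}, MeasurableSet C → MeasurableSet {y : ℕ → E | y i ∈ C} :=
    fun i C hC => measurable_pi_apply i hC
  -- stationarity moves the second coordinate to time `0`
  have hs0 : P.real {ω | Y0 1 ω ∈ B} = P.real {ω | Y0 0 ω ∈ B} := by
    have := congrArg (fun μ => μ.real {y : ℕ → E | y 0 ∈ B}) h.stationary_Y0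
    rw [map_measureReal_apply (measurable_pi_lambda _ fun i => h.measurable_Y0 (i + 1))
      (hev 0 hB), map_measureReal_apply m0 (hev 0 hB)] at this
    exact this
  have hs1 : P.real {ω | Y1 1 ω ∈ B} = P.real {ω | Y1 0 ω ∈ B} := by
    rw [measureReal_def, measureReal_def]
    exact congrArg ENNReal.toReal ((h.iid_Y1.2 1).measure_mem_eq hB)
  have hi1 : P.real {ω | Y1 0 ω ∈ A ∧ Y1 1 ω ∈ B} =
      P.real {ω | Y1 0 ω ∈ A} * P.real {ω | Y1 0 ω ∈ B} := by
    rw [← hs1]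
    have := (h.iid_Y1.1.indepFun zero_ne_one).measure_inter_preimage_eq_mul _ _ hA hB
    rw [measureReal_def, measureReal_def, measureReal_def, ← ENNReal.toReal_mul]
    exact congrArg ENNReal.toReal this
  have h00 := hX 0 0 {w | w.1 0 ∈ A ∧ w.1 1 ∈ B} (((hev 0 hA).inter (hev 1 hB)).preimage
    measurable_fst)
  have h01 := hX 0 1 {w | w.1 0 ∈ A ∧ w.2 1 ∈ B} (((hev 0 hA).preimage measurable_fst).inter
    ((hev 1 hB).preimage measurable_snd))
  have h10 := hX 1 0 {w | w.1 1 ∈ B ∧ w.2 0 ∈ A} (((hev 1 hB).preimage measurable_fst).inter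
    ((hev 0 hA).preimage measurable_snd))
  have h11 := hX 1 1 {w | w.2 0 ∈ A ∧ w.2 1 ∈ B} (((hev 0 hA).inter (hev 1 hB)).preimage
    measurable_snd)
  have g01 := hY _ _ (hev 0 hA) (hev 1 hB)
  have g10 := hY _ _ (hev 1 hB) (hev 0 hA)
  simp only [Set.mem_ofPred_eq] at h00 h01 h10 h11 g01 g10
  rw [g01, hs1] at h01
  rw [g10, hs0] at h10
  rw [hi1] at h11
  have mX : ∀ i, MeasurableSet {ω | X i ω = 0} :=
    fun i => h.measurable_X i (measurableSet_singleton 0)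
  set D : Set Ω := {ω | observed X Y0 Y1 0 ω ∈ A ∧ observed X Y0 Y1 1 ω ∈ B} with hD
  have hne : ∀ i ω, X i ω ≠ 0 ↔ X i ω = 1 := fun i ω => by
    generalize X i ω = a; fin_cases a <;> simp
  have e00 : D ∩ {ω | X 0 ω = 0} ∩ {ω | X 1 ω = 0} =
      {ω | (X 0 ω = 0 ∧ X 1 ω = 0) ∧ Y0 0 ω ∈ A ∧ Y0 1 ω ∈ B} := by
    ext ω
    simp only [hD, observed, Set.mem_inter_iff, Set.mem_ofPred_eq]
    constructor
    · rintro ⟨⟨h1, h2⟩, h3⟩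
      simpa [h2, h3] using h1
    · rintro ⟨⟨h2, h3⟩, h1⟩
      simpa [h2, h3] using h1
  have e01 : (D ∩ {ω | X 0 ω = 0}) \ {ω | X 1 ω = 0} =
      {ω | (X 0 ω = 0 ∧ X 1 ω = 1) ∧ Y0 0 ω ∈ A ∧ Y1 1 ω ∈ B} := by
    ext ω
    simp only [hD, observed, Set.mem_inter_iff, Set.mem_sdiff, Set.mem_ofPred_eq, hne]
    constructor
    · rintro ⟨⟨h1, h2⟩, h3⟩
      simpa [h2, h3] using h1
    · rintro ⟨⟨h2, h3⟩, h1⟩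
      simpa [h2, h3] using h1
  have e10 : (D \ {ω | X 0 ω = 0}) ∩ {ω | X 1 ω = 0} =
      {ω | (X 0 ω = 1 ∧ X 1 ω = 0) ∧ Y0 1 ω ∈ B ∧ Y1 0 ω ∈ A} := by
    ext ω
    simp only [hD, observed, Set.mem_inter_iff, Set.mem_sdiff, Set.mem_ofPred_eq, hne]
    constructor
    · rintro ⟨⟨h1, h2⟩, h3⟩
      simpa [h2, h3, and_comm] using h1
    · rintro ⟨⟨h2, h3⟩, h1⟩
      simpa [h2, h3, and_comm] using h1
  have e11 : (D \ {ω | X 0 ω = 0}) \ {ω | X 1 ω = 0} =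
      {ω | (X 0 ω = 1 ∧ X 1 ω = 1) ∧ Y1 0 ω ∈ A ∧ Y1 1 ω ∈ B} := by
    ext ω
    simp only [hD, observed, Set.mem_sdiff, Set.mem_ofPred_eq, hne]
    constructor
    · rintro ⟨⟨h1, h2⟩, h3⟩
      simpa [h2, h3] using h1
    · rintro ⟨⟨h2, h3⟩, h1⟩
      simpa [h2, h3] using h1
  rw [← measureReal_inter_add_sdiff (s := D) (mX 0),
    ← measureReal_inter_add_sdiff (s := D ∩ {ω | X 0 ω = 0}) (mX 1),
    ← measureReal_inter_add_sdiff (s := D \ {ω | X 0 ω = 0}) (mX 1), e00, e01, e10, e11, h00, h01,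
    h10, h11]
  simp [invariantVec, transMatrix, pOf, rOf, lam1, lam2, lam3, lam4]
  ring

end Model

/-! ### Consistency of minimizers of uniformly convergent functions -/

section Argmin

/-- Minimizers over a compact set of functions converging uniformly to a continuous function with a
unique minimizer `t` converge to `t`. -/
lemma tendsto_of_argmin {α : Type*} [TopologicalSpace α] {K : Set α} (hK : IsCompact K)
    {f : ℕ → α → ℝ} {g : α → ℝ} (hg : ContinuousOn g K) (hfg : TendstoUniformlyOn f g atTop K)
    {t : α} (ht : t ∈ K) (huniq : ∀ u ∈ K, g u ≤ g t → u = t) {u : ℕ → α}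
    (hu : ∀ᶠ n in atTop, u n ∈ K ∧ f n (u n) ≤ f n t) : Tendsto u atTop (𝓝 t) := by
  rw [tendsto_nhds]
  intro U hU htU
  obtain ⟨m, hm, hmK⟩ : ∃ m, g t < m ∧ ∀ v ∈ K \ U, m ≤ g v := by
    rcases (K \ U).eq_empty_or_nonempty with he | hne
    · exact ⟨g t + 1, by linarith, by simp [he]⟩
    · obtain ⟨v, hv, hmin⟩ := (hK.diff hU).exists_isMinOn hne (hg.mono Set.sdiff_subset)
      refine ⟨g v, ?_, fun w hw => hmin hw⟩
      by_contra! hle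
      exact hv.2 (huniq v hv.1 hle ▸ htU)
  rw [Metric.tendstoUniformlyOn_iff] at hfg
  filter_upwards [hu, hfg ((m - g t) / 2) (by linarith)] with n hn hn'
  by_contra hnU
  have h1 := hn' t ht
  have h2 := hn' (u n) hn.1
  have h3 := hmK (u n) ⟨hn.1, hnU⟩
  rw [Real.dist_eq, abs_lt] at h1 h2
  linarith [hn.2, h1.1, h2.2]

end Argmin

/-! ### Identification of the parameter -/

section Parameters

/-- As `lam3 + lam4 = r`, `lam1 + lam2 = p = 1 - r` and `lam2 = lam3`. -/
lemma lam_eq {θ : ℝ × ℝ} (h : θ.1 + θ.2 ≠ 0) : lam4 θ = 2 * rOf θ - 1 + lam1 θ := by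
  unfold lam4 rOf lam1
  field_simp
  ring

/-- The parameter is determined by `lam1` and `lam4 / r ^ 2`, the two quantities that the contrast
identifies. -/
lemma eq_of_lam1_eq_of_lam4_div_eq {θ η : ℝ × ℝ} (hθ1 : 0 < θ.1) (hθ2 : 0 < θ.2) (hη1 : 0 < η.1)
    (hη2 : 0 < η.2) (h1 : lam1 θ = lam1 η)
    (h4 : lam4 θ / rOf θ ^ 2 = lam4 η / rOf η ^ 2) : θ = η := by
  have hsθ : 0 < θ.1 + θ.2 := add_pos hθ1 hθ2
  have hsη : 0 < η.1 + η.2 := add_pos hη1 hη2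
  have hrθ : 0 < rOf θ := div_pos hθ1 hsθ
  have hrη : 0 < rOf η := div_pos hη1 hsη
  have hlt : ∀ {ξ : ℝ × ℝ}, 0 < ξ.1 → 0 < ξ.2 → rOf ξ < 1 - lam1 ξ := fun {ξ} ha hb => by
    have : 1 - lam1 ξ - rOf ξ = ξ.1 * ξ.2 / (ξ.1 + ξ.2) := by
      unfold lam1 rOf
      field_simp
      ring
    have : 0 < 1 - lam1 ξ - rOf ξ := by rw [this]; positivity
    linarith
  have hbθ := hlt hθ1 hθ2
  have hbη := hlt hη1 hη2
  -- `ρ ↦ (2 * ρ - b) / ρ ^ 2` is injective on `(0, b)`, where `b = 1 - lam1`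
  have hr : rOf θ = rOf η := by
    rw [lam_eq hsθ.ne', lam_eq hsη.ne', h1, div_eq_div_iff (by positivity) (by positivity)] at h4
    rw [h1] at hbθ
    set ρ := rOf θ
    set σ := rOf η
    set a := lam1 η
    have hfac : (ρ - σ) * ((1 - a) * (ρ + σ) - 2 * (ρ * σ)) = 0 := by linarith
    rcases mul_eq_zero.1 hfac with h | h
    · linarith
    · nlinarith
  have hp : ∀ {ξ : ℝ × ℝ}, ξ.1 + ξ.2 ≠ 0 → lam1 ξ = (1 - rOf ξ) * (1 - ξ.1) := fun {ξ} h => by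
    unfold lam1 rOf
    field_simp
    ring
  have hrlt : 0 < 1 - rOf η := by
    have : 1 - rOf η = η.2 / (η.1 + η.2) := by unfold rOf; field_simp; ring
    rw [this]; positivity
  have ha : θ.1 = η.1 := by
    rw [hp hsθ.ne', hp hsη.ne', hr] at h1
    have := mul_left_cancel₀ hrlt.ne' h1
    linarith
  have hb : θ.2 = η.2 := by
    have e1 : rOf θ * (θ.1 + θ.2) = θ.1 := div_mul_cancel₀ _ hsθ.ne'
    have e2 : rOf η * (η.1 + η.2) = η.1 := div_mul_cancel₀ _ hsη.ne'
    rw [hr, ha] at e1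
    have := mul_left_cancel₀ hrη.ne' (e1.trans e2.symm)
    linarith
  exact Prod.ext ha hb

lemma pos_of_mem_paramSpace {δ : ℝ} (hδ : 0 < δ) {θ : ℝ × ℝ} (h : θ ∈ paramSpace δ) :
    (0 < θ.1 ∧ θ.1 < 1) ∧ 0 < θ.2 ∧ θ.2 < 1 := by
  obtain ⟨⟨h1, h2⟩, h3, h4⟩ := h
  refine ⟨⟨?_, ?_⟩, ?_, ?_⟩ <;> linarith

lemma isCompact_paramSpace (δ : ℝ) : IsCompact (paramSpace δ) := isCompact_Icc.prod isCompact_Icc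

end Parameters

/-! ### The deviation as a function of the parameter and of the cdfs -/

section Deviation

variable {E : Type*}

/-- The coefficients of `G⁰`, `F⁰ ⊗ F⁰`, `F⁰ ⊗ A + A ⊗ F⁰` and `A ⊗ A` in the second-order cdf
rebuilt from a first-order cdf `A` under the parameter `θ`. -/
def coef (θ : ℝ × ℝ) : Fin 4 → ℝ :=
  ![lam1 θ, lam4 θ * (1 / rOf θ * pOf θ) ^ 2 - 2 * lam2 θ * (1 / rOf θ * pOf θ),
    lam2 θ * (1 / rOf θ) - lam4 θ * (1 / rOf θ) ^ 2 * pOf θ, lam4 θ * (1 / rOf θ) ^ 2]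

/-- The deviation between a second-order cdf `B` and the one rebuilt from a first-order cdf `A`
under the parameter `θ`. -/
def deviation (F0 : E → ℝ) (G0 : E × E → ℝ) (A : E → ℝ) (B : E × E → ℝ) (θ : ℝ × ℝ)
    (w : E × E) : ℝ :=
  B w - (coef θ 0 * G0 w + coef θ 1 * (F0 w.1 * F0 w.2) +
    coef θ 2 * (F0 w.1 * A w.2 + A w.1 * F0 w.2) + coef θ 3 * (A w.1 * A w.2))

lemma empDev_eq_deviation {E : Set ℝ} (F0 : E → ℝ) (G0 : E → E → ℝ) (z : ℕ → E) (n : ℕ)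
    (θ : ℝ × ℝ) (w : E × E) :
    empDev F0 G0 z n θ w.1 w.2 = deviation F0 (fun w => G0 w.1 w.2) (empCdf1 z n)
      (fun w => empCdf2 z n w.1 w.2) θ w := by
  have h : lam3 θ = lam2 θ := rfl
  simp only [empDev, empF1, deviation, coef, h, Matrix.cons_val_zero, Matrix.cons_val_one,
    Matrix.cons_val]
  ring

/-- When `A` and `B` are the cdfs produced by the parameter `η`, the deviation at `θ` is a linear
combination of the two functions in the condition `LinInd`. The reason is that `F - F⁰ = r_η (F¹ - F⁰)`,
so the cdf rebuilt under `θ` is `F⁰ + (r_η / r_θ) (F¹ - F⁰)`. -/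
lemma deviation_eq_of_mixture {F0 F1 F : E → ℝ} {G0 G : E × E → ℝ} {η θ : ℝ × ℝ}
    (hη : 0 < η.1 ∧ 0 < η.2) (hθ : 0 < θ.1 ∧ 0 < θ.2)
    (hF : ∀ x, F x = pOf η * F0 x + rOf η * F1 x)
    (hG : ∀ w, G w = lam1 η * G0 w + lam2 η * (F0 w.1 * F1 w.2) + lam3 η * (F1 w.1 * F0 w.2) +
      lam4 η * (F1 w.1 * F1 w.2)) (w : E × E) :
    deviation F0 G0 F G θ w = (lam1 η - lam1 θ) * (G0 w - F0 w.1 * F0 w.2) +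
      (lam4 η - lam4 θ * (rOf η / rOf θ) ^ 2) *
        ((F1 w.1 - F0 w.1) * (F1 w.2 - F0 w.2)) := by
  have hsη : η.1 + η.2 ≠ 0 := (add_pos hη.1 hη.2).ne'
  have hsθ : θ.1 + θ.2 ≠ 0 := (add_pos hθ.1 hθ.2).ne'
  have hr : rOf θ ≠ 0 := (div_pos hθ.1 (add_pos hθ.1 hθ.2)).ne'
  have id1 : ∀ {ξ : ℝ × ℝ}, ξ.1 + ξ.2 ≠ 0 → pOf ξ = 1 - rOf ξ := fun {ξ} h => by
    unfold pOf rOf; field_simp; ring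
  have id2 : ∀ {ξ : ℝ × ℝ}, ξ.1 + ξ.2 ≠ 0 → lam2 ξ = 1 - rOf ξ - lam1 ξ := fun {ξ} h => by
    unfold lam1 lam2 rOf; field_simp; ring
  have id3 : ∀ ξ : ℝ × ℝ, lam3 ξ = lam2 ξ := fun ξ => rfl
  simp only [deviation, coef, Matrix.cons_val_zero, Matrix.cons_val_one, Matrix.cons_val, hF, hG,
    id3, id1 hsη, id1 hsθ, id2 hsη, id2 hsθ, lam_eq hsη, lam_eq hsθ]
  field_simp
  ring

lemma continuousOn_coef {δ : ℝ} (hδ : 0 < δ) : ContinuousOn coef (paramSpace δ) := by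
  have hs : ∀ θ ∈ paramSpace δ, θ.1 + θ.2 ≠ 0 := fun θ hθ =>
    have h := pos_of_mem_paramSpace hδ hθ
    (add_pos h.1.1 h.2.1).ne'
  have hr0 : ∀ θ ∈ paramSpace δ, rOf θ ≠ 0 := fun θ hθ =>
    have h := pos_of_mem_paramSpace hδ hθ
    (div_pos h.1.1 (add_pos h.1.1 h.2.1)).ne'
  have hp : ContinuousOn pOf (paramSpace δ) := by
    unfold pOf; exact ContinuousOn.div (by fun_prop) (by fun_prop) hs
  have hr : ContinuousOn rOf (paramSpace δ) := by
    unfold rOf; exact ContinuousOn.div (by fun_prop) (by fun_prop) hs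
  have h1 : ContinuousOn lam1 (paramSpace δ) := by
    unfold lam1; exact ContinuousOn.div (by fun_prop) (by fun_prop) hs
  have h2 : ContinuousOn lam2 (paramSpace δ) := by
    unfold lam2; exact ContinuousOn.div (by fun_prop) (by fun_prop) hs
  have h4 : ContinuousOn lam4 (paramSpace δ) := by
    unfold lam4; exact ContinuousOn.div (by fun_prop) (by fun_prop) hs
  have hri : ContinuousOn (fun θ => 1 / rOf θ) (paramSpace δ) := continuousOn_const.div hr hr0
  refine continuousOn_pi.2 fun i => ?_
  fin_cases i
  · exact h1
  · exact (h4.mul ((hri.mul hp).pow 2)).sub ((continuousOn_const.mul h2).mul (hri.mul hp))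
  · exact (h2.mul hri).sub ((h4.mul (hri.pow 2)).mul hp)
  · exact h4.mul (hri.pow 2)

variable {F0 A A' : E → ℝ} {G0 B B' : E × E → ℝ}

lemma abs_coef_combination_le (c : Fin 4 → ℝ) (hF0 : ∀ x, |F0 x| ≤ 1) (hG0 : ∀ w, |G0 w| ≤ 1)
    (hA : ∀ x, |A x| ≤ 1) (w : E × E) :
    |c 0 * G0 w + c 1 * (F0 w.1 * F0 w.2) + c 2 * (F0 w.1 * A w.2 + A w.1 * F0 w.2) +
      c 3 * (A w.1 * A w.2)| ≤ 5 * ‖c‖ := by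
  have hc : ∀ i, |c i| ≤ ‖c‖ := fun i => norm_le_pi_norm c i
  have hmul : ∀ {a b : ℝ}, |a| ≤ 1 → |b| ≤ 1 → |a * b| ≤ 1 := fun {a b} ha hb => by
    rw [abs_mul]; exact mul_le_one₀ ha (abs_nonneg _) hb
  have hterm : ∀ (i : Fin 4) {a m : ℝ}, |a| ≤ m → |c i * a| ≤ ‖c‖ * m := fun i a m ha => by
    rw [abs_mul]; exact mul_le_mul (hc i) ha (abs_nonneg _) (norm_nonneg _)
  have h1 := hterm 0 (hG0 w)
  have h2 := hterm 1 (hmul (hF0 w.1) (hF0 w.2))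
  have h3 := hterm 2 ((abs_add_le _ _).trans (add_le_add (hmul (hF0 w.1) (hA w.2))
    (hmul (hA w.1) (hF0 w.2))))
  have h4 := hterm 3 (hmul (hA w.1) (hA w.2))
  refine (abs_add_le _ _).trans ((add_le_add ((abs_add_le _ _).trans
    (add_le_add (abs_add_le _ _) le_rfl)) le_rfl).trans ?_)
  linarith

lemma abs_deviation_le (hF0 : ∀ x, |F0 x| ≤ 1) (hG0 : ∀ w, |G0 w| ≤ 1)
    (hA : ∀ x, |A x| ≤ 1) (hB : ∀ w, |B w| ≤ 1) (θ : ℝ × ℝ) (w : E × E) :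
    |deviation F0 G0 A B θ w| ≤ 1 + 5 * ‖coef θ‖ :=
  (abs_sub _ _).trans (add_le_add (hB w) (abs_coef_combination_le _ hF0 hG0 hA w))

/-- Lipschitz dependence of the deviation on the coefficients, uniformly over `E × E`. -/
lemma abs_deviation_sub_le_of_param (hF0 : ∀ x, |F0 x| ≤ 1) (hG0 : ∀ w, |G0 w| ≤ 1)
    (hA : ∀ x, |A x| ≤ 1) (θ θ' : ℝ × ℝ) (w : E × E) :
    |deviation F0 G0 A B θ w - deviation F0 G0 A B θ' w| ≤ 5 * ‖coef θ - coef θ'‖ := by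
  rw [abs_sub_comm]
  convert abs_coef_combination_le (coef θ - coef θ') hF0 hG0 hA w using 2
  simp only [deviation, Pi.sub_apply]
  ring

/-- Lipschitz dependence of the deviation on the cdfs for the uniform distance. -/
lemma abs_deviation_sub_le_of_cdf (hF0 : ∀ x, |F0 x| ≤ 1) (hA : ∀ x, |A x| ≤ 1)
    (hA' : ∀ x, |A' x| ≤ 1) {ε : ℝ} (hAA : ∀ x, |A x - A' x| ≤ ε) (hBB : ∀ w, |B w - B' w| ≤ ε)
    (θ : ℝ × ℝ) (w : E × E) :
    |deviation F0 G0 A B θ w - deviation F0 G0 A' B' θ w| ≤ (1 + 4 * ‖coef θ‖) * ε := by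
  have hc : ∀ i, |coef θ i| ≤ ‖coef θ‖ := fun i => norm_le_pi_norm (coef θ) i
  have hmul : ∀ {a b : ℝ}, |a| ≤ 1 → |b| ≤ ε → |a * b| ≤ ε := fun {a b} ha hb => by
    rw [abs_mul]; exact (mul_le_of_le_one_left (abs_nonneg _) ha).trans hb
  have hterm : ∀ (i : Fin 4) {a m : ℝ}, |a| ≤ m → |coef θ i * a| ≤ ‖coef θ‖ * m :=
    fun i a m ha => by
      rw [abs_mul]; exact mul_le_mul (hc i) ha (abs_nonneg _) (norm_nonneg _)
  have e : deviation F0 G0 A B θ w - deviation F0 G0 A' B' θ w = (B w - B' w) -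
      (coef θ 2 * (F0 w.1 * (A w.2 - A' w.2) + F0 w.2 * (A w.1 - A' w.1)) +
        coef θ 3 * (A w.1 * (A w.2 - A' w.2) + A' w.2 * (A w.1 - A' w.1))) := by
    simp only [deviation]
    ring
  have h2 := hterm 2 ((abs_add_le _ _).trans (add_le_add (hmul (hF0 w.1) (hAA w.2))
    (hmul (hF0 w.2) (hAA w.1))))
  have h3 := hterm 3 ((abs_add_le _ _).trans (add_le_add (hmul (hA w.1) (hAA w.2))
    (hmul (hA' w.2) (hAA w.1))))
  rw [e]
  refine (abs_sub _ _).trans ((add_le_add (hBB w) ((abs_add_le _ _).trans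
    (add_le_add h2 h3))).trans_eq ?_)
  ring

lemma measurable_deviation [MeasurableSpace E] (hF0 : Measurable F0) (hG0 : Measurable G0)
    (hA : Measurable A) (hB : Measurable B) (θ : ℝ × ℝ) :
    Measurable (deviation F0 G0 A B θ) := by
  unfold deviation
  fun_prop

end Deviation

/-! ### Contrast functionals -/

section Contrast

variable {W : Type*} [MeasurableSpace W]

/-- A functional that is Lipschitz for the uniform distance on uniformly bounded families of measurable
functions, that vanishes at `0`, and that is nonpositive only at functions that are zero `H`-almost
everywhere. The mean square and the supremum norm are the two instances; being everywhere defined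
through `∫` and `⨆`, they are controlled on bounded measurable functions only. -/
structure IsContrast (H : Measure W) (Φ : (W → ℝ) → ℝ) : Prop where
  lipschitz : ∀ M : ℝ, ∃ L : ℝ, 0 ≤ L ∧ ∀ f g : W → ℝ, Measurable f → Measurable g →
    (∀ w, |f w| ≤ M) → (∀ w, |g w| ≤ M) → ∀ ε : ℝ, (∀ w, |f w - g w| ≤ ε) →
      |Φ f - Φ g| ≤ L * ε
  map_zero : Φ 0 = 0
  ae_eq_zero : ∀ (M : ℝ) (f : W → ℝ), Measurable f → (∀ w, |f w| ≤ M) → Φ f ≤ 0 →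
    ∀ᵐ w ∂H, f w = 0

lemma isContrast_integral_sq (H : Measure W) [IsProbabilityMeasure H] :
    IsContrast H fun f => ∫ w, f w ^ 2 ∂H := by
  have hint : ∀ (M : ℝ) (f : W → ℝ), Measurable f → (∀ w, |f w| ≤ M) →
      Integrable (fun w => f w ^ 2) H := fun M f hf hM => by
    refine Integrable.of_bound (hf.pow_const 2).aestronglyMeasurable (M ^ 2)
      (Eventually.of_forall fun w => ?_)
    rw [norm_pow, Real.norm_eq_abs]
    exact pow_le_pow_left₀ (abs_nonneg _) (hM w) 2
  refine ⟨fun M => ?_, by simp, fun M f hf hM h => ?_⟩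
  · refine ⟨2 * |M|, by positivity, fun f g hf hg hfM hgM ε hε => ?_⟩
    rw [← integral_sub (hint M f hf hfM) (hint M g hg hgM), ← Real.norm_eq_abs]
    refine (norm_integral_le_of_norm_le_const (C := 2 * |M| * ε)
      (Eventually.of_forall fun w => ?_)).trans_eq (by simp)
    have : f w ^ 2 - g w ^ 2 = (f w + g w) * (f w - g w) := by ring
    rw [this, Real.norm_eq_abs, abs_mul]
    refine mul_le_mul ((abs_add_le _ _).trans ?_) (hε w) (abs_nonneg _) (by positivity)
    linarith [hfM w, hgM w, le_abs_self M]
  · have h0 : ∫ w, f w ^ 2 ∂H = 0 := le_antisymm h (integral_nonneg fun w => sq_nonneg _)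
    rw [integral_eq_zero_iff_of_nonneg (fun w => sq_nonneg _) (hint M f hf hM)] at h0
    filter_upwards [h0] with w hw
    simpa using hw

lemma isContrast_iSup_abs [Nonempty W] (H : Measure W) : IsContrast H fun f => ⨆ w, |f w| := by
  have hbdd : ∀ (M : ℝ) (f : W → ℝ), (∀ w, |f w| ≤ M) → BddAbove (Set.range fun w => |f w|) :=
    fun M f hM => ⟨M, by rintro _ ⟨w, rfl⟩; exact hM w⟩
  refine ⟨fun M => ⟨1, zero_le_one, fun f g _ _ hfM hgM ε hε => ?_⟩, by simp,
    fun M f _ hM h => Eventually.of_forall fun w => ?_⟩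
  · have key : ∀ f g : W → ℝ, (∀ w, |g w| ≤ M) → (∀ w, |f w - g w| ≤ ε) →
        ⨆ w, |f w| ≤ (⨆ w, |g w|) + ε := fun f g hg h => ciSup_le fun w => by
      have h1 := le_ciSup (hbdd M g hg) w
      have h2 := abs_add_le (f w - g w) (g w)
      rw [sub_add_cancel] at h2
      linarith [h w]
    have h1 := key f g hgM hε
    have h2 := key g f hfM fun w => by rw [abs_sub_comm]; exact hε w
    rw [one_mul, abs_le]
    constructor <;> linarith
  · exact abs_nonpos_iff.1 ((le_ciSup (hbdd M f hM) w).trans h)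

variable {E : Type*} [MeasurableSpace E] {H : Measure (E × E)} {Φ : (E × E → ℝ) → ℝ}
  {F0 A : E → ℝ} {G0 B : E × E → ℝ} {δ : ℝ}

lemma exists_norm_coef_le (hδ : 0 < δ) : ∃ K : ℝ, 0 ≤ K ∧ ∀ θ ∈ paramSpace δ, ‖coef θ‖ ≤ K := by
  obtain ⟨K, hK⟩ := (isCompact_paramSpace δ).exists_bound_of_continuousOn (continuousOn_coef hδ)
  exact ⟨max K 0, le_max_right _ _, fun θ hθ => (hK θ hθ).trans (le_max_left _ _)⟩

lemma IsContrast.continuousOn_deviation (hΦ : IsContrast H Φ) (hδ : 0 < δ)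
    (mF0 : Measurable F0) (mG0 : Measurable G0) (mA : Measurable A) (mB : Measurable B)
    (hF0 : ∀ x, |F0 x| ≤ 1) (hG0 : ∀ w, |G0 w| ≤ 1) (hA : ∀ x, |A x| ≤ 1) (hB : ∀ w, |B w| ≤ 1) :
    ContinuousOn (fun θ => Φ (deviation F0 G0 A B θ)) (paramSpace δ) := by
  obtain ⟨K, hK0, hK⟩ := exists_norm_coef_le hδ
  obtain ⟨L, hL0, hL⟩ := hΦ.lipschitz (1 + 5 * K)
  have hM : ∀ θ ∈ paramSpace δ, ∀ w, |deviation F0 G0 A B θ w| ≤ 1 + 5 * K := fun θ hθ w =>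
    (abs_deviation_le hF0 hG0 hA hB θ w).trans (by linarith [hK θ hθ])
  intro θ hθ
  refine tendsto_iff_dist_tendsto_zero.2 ?_
  have hc : Tendsto (fun θ' => L * (5 * ‖coef θ' - coef θ‖)) (𝓝[paramSpace δ] θ) (𝓝 0) := by
    have := tendsto_iff_norm_sub_tendsto_zero.1 (continuousOn_coef hδ θ hθ)
    simpa using (this.const_mul 5).const_mul L
  refine squeeze_zero' (Eventually.of_forall fun _ => dist_nonneg) ?_ hc
  filter_upwards [self_mem_nhdsWithin] with θ' hθ'
  rw [Real.dist_eq]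
  exact hL _ _ (measurable_deviation mF0 mG0 mA mB _) (measurable_deviation mF0 mG0 mA mB _)
    (hM θ' hθ') (hM θ hθ) _ (abs_deviation_sub_le_of_param hF0 hG0 hA θ' θ)

lemma IsContrast.tendstoUniformlyOn_deviation (hΦ : IsContrast H Φ) (hδ : 0 < δ)
    {An : ℕ → E → ℝ} {Bn : ℕ → E × E → ℝ}
    (mF0 : Measurable F0) (mG0 : Measurable G0) (mA : Measurable A) (mB : Measurable B)
    (mAn : ∀ n, Measurable (An n)) (mBn : ∀ n, Measurable (Bn n))
    (hF0 : ∀ x, |F0 x| ≤ 1) (hG0 : ∀ w, |G0 w| ≤ 1) (hA : ∀ x, |A x| ≤ 1) (hB : ∀ w, |B w| ≤ 1)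
    (hAn : ∀ᶠ n in atTop, ∀ x, |An n x| ≤ 1) (hBn : ∀ᶠ n in atTop, ∀ w, |Bn n w| ≤ 1)
    (hAA : TendstoUniformly An A atTop) (hBB : TendstoUniformly Bn B atTop) :
    TendstoUniformlyOn (fun n θ => Φ (deviation F0 G0 (An n) (Bn n) θ))
      (fun θ => Φ (deviation F0 G0 A B θ)) atTop (paramSpace δ) := by
  obtain ⟨K, hK0, hK⟩ := exists_norm_coef_le hδ
  obtain ⟨L, hL0, hL⟩ := hΦ.lipschitz (1 + 5 * K)
  rw [Metric.tendstoUniformlyOn_iff]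
  rw [Metric.tendstoUniformly_iff] at hAA hBB
  intro ε hε
  set C : ℝ := L * (1 + 4 * K) with hC
  have hC0 : 0 ≤ C := by positivity
  have hη : 0 < ε / (C + 1) := by positivity
  filter_upwards [hAn, hBn, hAA _ hη, hBB _ hη] with n h1 h2 h3 h4 θ hθ
  have hd := hL (deviation F0 G0 A B θ) (deviation F0 G0 (An n) (Bn n) θ)
    (measurable_deviation mF0 mG0 mA mB _) (measurable_deviation mF0 mG0 (mAn n) (mBn n) _)
    (fun w => (abs_deviation_le hF0 hG0 hA hB θ w).trans (by linarith [hK θ hθ]))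
    (fun w => (abs_deviation_le hF0 hG0 h1 h2 θ w).trans (by linarith [hK θ hθ])) _
    (abs_deviation_sub_le_of_cdf hF0 hA h1 (fun x => (h3 x).le) (fun w => (h4 w).le) θ)
  rw [Real.dist_eq]
  calc _ ≤ _ := hd
    _ ≤ L * ((1 + 4 * K) * (ε / (C + 1))) := by gcongr; exact hK θ hθ
    _ = C * (ε / (C + 1)) := by rw [hC]; ring
    _ < (C + 1) * (ε / (C + 1)) := by gcongr; linarith
    _ = ε := by field_simp

end Contrast

/-! ### Empirical and theoretical cdfs -/

section Empirical

variable {E : Set ℝ}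

lemma empCdf1_eq_pairFreq (z : ℕ → E) (n : ℕ) (x : E) :
    empCdf1 z n x =
      pairFreq z n {s | ((s.1 : ℝ) : EReal) ≤ ((x : ℝ) : EReal) ∧ ((s.2 : ℝ) : EReal) ≤ ⊤} := by
  simp only [empCdf1, pairFreq, one_div, le_top, and_true, EReal.coe_le_coe_iff]
  rfl

/-- For `n ≥ 1` the truncated subtraction `n - 1` agrees with the real one in the normalization. -/
lemma empCdf2_eq_pairFreq (z : ℕ → E) {n : ℕ} (hn : 1 ≤ n) (x y : E) :
    empCdf2 z n x y = pairFreq z (n - 1)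
      {s | ((s.1 : ℝ) : EReal) ≤ ((x : ℝ) : EReal) ∧ ((s.2 : ℝ) : EReal) ≤ ((y : ℝ) : EReal)} := by
  simp only [empCdf2, pairFreq, one_div, EReal.coe_le_coe_iff, Nat.cast_sub hn, Nat.cast_one]
  rfl

lemma abs_pairFreq_le_one (z : ℕ → E) (n : ℕ) (A : Set (E × E)) : |pairFreq z n A| ≤ 1 := by
  have h0 : 0 ≤ pairFreq z n A := mul_nonneg (by positivity)
    (Finset.sum_nonneg fun i _ => Set.indicator_nonneg (fun _ _ => zero_le_one) _)
  rw [abs_of_nonneg h0, pairFreq]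
  rcases Nat.eq_zero_or_pos n with rfl | hn
  · simp
  have hn' : (0 : ℝ) < n := Nat.cast_pos.2 hn
  rw [inv_mul_le_iff₀ hn', mul_one]
  refine (Finset.sum_le_sum (g := fun _ => (1 : ℝ)) fun i _ => ?_).trans (by simp)
  exact Set.indicator_le_self' (f := fun _ => (1 : ℝ)) (fun _ _ => zero_le_one) _

lemma measurable_empCdf1 (z : ℕ → E) (n : ℕ) : Measurable (empCdf1 z n) := by
  unfold empCdf1
  refine measurable_const.mul (Finset.measurable_sum _ fun i _ => ?_)
  exact Measurable.ite (p := fun x : E => z i ≤ x) (measurableSet_le measurable_const measurable_id)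
    measurable_const measurable_const

lemma measurable_empCdf2 (z : ℕ → E) (n : ℕ) :
    Measurable fun w : E × E => empCdf2 z n w.1 w.2 := by
  unfold empCdf2
  refine measurable_const.mul (Finset.measurable_sum _ fun i _ => ?_)
  have h1 : MeasurableSet {w : E × E | z i ≤ w.1} := measurableSet_le measurable_const measurable_fst
  have h2 : MeasurableSet {w : E × E | z (i + 1) ≤ w.2} :=
    measurableSet_le measurable_const measurable_snd
  exact Measurable.ite (p := fun w : E × E => z i ≤ w.1 ∧ z (i + 1) ≤ w.2) (h1.inter h2)
    measurable_const measurable_const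

variable {Ω : Type*} [MeasurableSpace Ω] {P : Measure Ω} [IsProbabilityMeasure P]
  {Y : ℕ → Ω → E}

lemma measurable_cdf2 (hY : ∀ i, Measurable (Y i)) :
    Measurable fun w : E × E => cdf2 P Y w.1 w.2 := by
  have h1 : MeasurableSet {q : (E × E) × Ω | Y 0 q.2 ≤ q.1.1} :=
    measurableSet_le ((hY 0).comp measurable_snd) (measurable_fst.comp measurable_fst)
  have h2 : MeasurableSet {q : (E × E) × Ω | Y 1 q.2 ≤ q.1.2} :=
    measurableSet_le ((hY 1).comp measurable_snd) (measurable_snd.comp measurable_fst)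
  have hm : MeasurableSet {q : (E × E) × Ω | Y 0 q.2 ≤ q.1.1 ∧ Y 1 q.2 ≤ q.1.2} := h1.inter h2
  exact (measurable_measure_prodMk_left (ν := P) hm).ennreal_toReal

lemma measurable_cdf1 (hY : ∀ i, Measurable (Y i)) : Measurable (cdf1 P Y) := by
  have hm : MeasurableSet {q : E × Ω | Y 0 q.2 ≤ q.1} :=
    measurableSet_le ((hY 0).comp measurable_snd) measurable_fst
  exact (measurable_measure_prodMk_left (ν := P) hm).ennreal_toReal

lemma abs_cdf1_le_one (x : E) : |cdf1 P Y x| ≤ 1 := by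
  rw [cdf1, abs_of_nonneg measureReal_nonneg]
  exact measureReal_le_one

lemma abs_cdf2_le_one (w : E × E) : |cdf2 P Y w.1 w.2| ≤ 1 := by
  rw [cdf2, abs_of_nonneg measureReal_nonneg]
  exact measureReal_le_one

variable {θ : ℝ × ℝ} {X : ℕ → Ω → Fin 2} {Y0 Y1 : ℕ → Ω → E}

lemma ae_tendstoUniformly_empCdf (h : IsPoisoningModel P θ X Y0 Y1) (h0 : 0 < θ.1 + θ.2)
    (h2 : θ.1 + θ.2 < 2) :
    ∀ᵐ ω ∂P, TendstoUniformly (fun n => empCdf1 (fun i => observed X Y0 Y1 i ω) n)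
        (cdf1 P (observed X Y0 Y1)) atTop ∧
      TendstoUniformly (fun n (w : E × E) => empCdf2 (fun i => observed X Y0 Y1 i ω) n w.1 w.2)
        (fun w => cdf2 P (observed X Y0 Y1) w.1 w.2) atTop := by
  have hZ : Measurable fun ω => (observed X Y0 Y1 0 ω, observed X Y0 Y1 1 ω) :=
    (measurable_observed h 0).prodMk (measurable_observed h 1)
  have hmeas : ∀ p : EReal × EReal, MeasurableSet
      {s : E × E | ((s.1 : ℝ) : EReal) ≤ p.1 ∧ ((s.2 : ℝ) : EReal) ≤ p.2} := fun p =>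
    (measurableSet_le (measurable_coe_real_ereal.comp (measurable_subtype_coe.comp measurable_fst))
      measurable_const).inter
    (measurableSet_le (measurable_coe_real_ereal.comp (measurable_subtype_coe.comp measurable_snd))
      measurable_const)
  filter_upwards [ae_tendstoUniformly_pairFreq h h0 h2] with ω hω
  rw [Metric.tendstoUniformly_iff] at hω
  constructor
  · rw [Metric.tendstoUniformly_iff]
    intro ε hε
    filter_upwards [hω ε hε] with n hn x
    have := hn (((x : ℝ) : EReal), ⊤)
    rw [map_measureReal_apply hZ (hmeas _), ← empCdf1_eq_pairFreq] at this
    simpa [cdf1] using this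
  · rw [Metric.tendstoUniformly_iff]
    intro ε hε
    filter_upwards [(tendsto_sub_atTop_nat 1).eventually (hω ε hε), eventually_ge_atTop 1]
      with n hn hn1 w
    have := hn (((w.1 : ℝ) : EReal), ((w.2 : ℝ) : EReal))
    rw [map_measureReal_apply hZ (hmeas _), ← empCdf2_eq_pairFreq _ hn1] at this
    simpa [cdf2] using this

lemma cdf2_observed (h : IsPoisoningModel P θ X Y0 Y1) (w : E × E) :
    cdf2 P (observed X Y0 Y1) w.1 w.2 = lam1 θ * cdf2 P Y0 w.1 w.2 +
      lam2 θ * (cdf1 P Y0 w.1 * cdf1 P Y1 w.2) + lam3 θ * (cdf1 P Y1 w.1 * cdf1 P Y0 w.2) +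
      lam4 θ * (cdf1 P Y1 w.1 * cdf1 P Y1 w.2) :=
  measureReal_observed_pair h (A := Set.Iic w.1) (B := Set.Iic w.2) measurableSet_Iic
    measurableSet_Iic

/-- The first-order cdf of the observations is the mixture `p F⁰ + r F¹`: the pair law with the second
event trivial. -/
lemma cdf1_observed (h : IsPoisoningModel P θ X Y0 Y1) (h0 : θ.1 + θ.2 ≠ 0) (x : E) :
    cdf1 P (observed X Y0 Y1) x = pOf θ * cdf1 P Y0 x + rOf θ * cdf1 P Y1 x := by
  have := measureReal_observed_pair h (A := Set.Iic x) (B := Set.univ) measurableSet_Iic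
    MeasurableSet.univ
  simp only [Set.mem_Iic, Set.mem_univ, and_true, Set.ofPred_true, probReal_univ, mul_one] at this
  rw [cdf1, this]
  simp only [cdf1, lam1, lam2, lam3, lam4, pOf, rOf]
  field_simp
  ring

end Empirical

/-! ### Strong consistency -/

section Consistency

variable {Ω : Type*} [MeasurableSpace Ω] {P : Measure Ω} [IsProbabilityMeasure P] {E : Set ℝ}
  {H : Measure (E × E)} {δ : ℝ} {θstar : ℝ × ℝ} {X : ℕ → Ω → Fin 2}
  {Y0 Y1 : ℕ → Ω → E} {Φ : (E × E → ℝ) → ℝ}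

/-- Existence of minimizers: the contrast is continuous on the compact set `Θ`. -/
lemma argminOn_contrast_nonempty (hΦ : IsContrast H Φ) (hδ : 0 < δ) (hδ1 : δ < 1 / 2)
    (hm : ∀ i, Measurable (Y0 i)) {n : ℕ} (hn : 2 ≤ n) (z : ℕ → E) :
    (argminOn (fun θ => Φ fun w => empDev (cdf1 P Y0) (cdf2 P Y0) z n θ w.1 w.2)
      (paramSpace δ)).Nonempty := by
  have hne : (paramSpace δ).Nonempty :=
    ⟨(δ, δ), ⟨le_rfl, by dsimp only; linarith⟩, ⟨le_rfl, by dsimp only; linarith⟩⟩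
  simp_rw [empDev_eq_deviation]
  obtain ⟨θ, hθ, hmin⟩ := (isCompact_paramSpace δ).exists_isMinOn hne
    (hΦ.continuousOn_deviation hδ (measurable_cdf1 (P := P) hm) (measurable_cdf2 (P := P) hm)
      (measurable_empCdf1 z n) (measurable_empCdf2 z n) abs_cdf1_le_one abs_cdf2_le_one
      (fun x => by rw [empCdf1_eq_pairFreq]; exact abs_pairFreq_le_one _ _ _)
      (fun w => by
        rw [empCdf2_eq_pairFreq z (by omega)]; exact abs_pairFreq_le_one _ _ _))
  exact ⟨θ, hθ, fun u hu => hmin hu⟩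

variable [IsProbabilityMeasure H]

omit [IsProbabilityMeasure P] in
/-- Identifiability: if the limit deviation vanishes `H`-almost everywhere at `θ`, linear independence on
the set where it vanishes forces both of its coefficients to be zero. -/
lemma LinInd.eq_of_ae_eq_zero {F0 F1 F : E → ℝ} {G0 : E → E → ℝ} {G : E × E → ℝ}
    (hlin : LinInd H F0 F1 G0) {η θ : ℝ × ℝ} (hη : 0 < η.1 ∧ 0 < η.2) (hθ : 0 < θ.1 ∧ 0 < θ.2)
    (hF : ∀ x, F x = pOf η * F0 x + rOf η * F1 x)
    (hG : ∀ w, G w = lam1 η * G0 w.1 w.2 + lam2 η * (F0 w.1 * F1 w.2) +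
      lam3 η * (F1 w.1 * F0 w.2) + lam4 η * (F1 w.1 * F1 w.2))
    (hm : Measurable (deviation F0 (fun w => G0 w.1 w.2) F G θ))
    (h : ∀ᵐ w ∂H, deviation F0 (fun w => G0 w.1 w.2) F G θ w = 0) : θ = η := by
  have hΓ : MeasurableSet {w | deviation F0 (fun w => G0 w.1 w.2) F G θ w = 0} :=
    hm (measurableSet_singleton 0)
  have hli := hlin _ hΓ ((prob_compl_eq_zero_iff hΓ).1 h)
  rw [LinearIndependent.pair_iff] at hli
  obtain ⟨h1, h4⟩ := hli (lam1 η - lam1 θ) (lam4 η - lam4 θ * (rOf η / rOf θ) ^ 2) (by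
    funext w
    have hw : deviation F0 (fun w => G0 w.1 w.2) F G θ w.1 = 0 := w.2
    rw [deviation_eq_of_mixture hη hθ hF hG] at hw
    exact hw)
  have hr : rOf θ ≠ 0 := (div_pos hθ.1 (add_pos hθ.1 hθ.2)).ne'
  have hr' : rOf η ≠ 0 := (div_pos hη.1 (add_pos hη.1 hη.2)).ne'
  refine eq_of_lam1_eq_of_lam4_div_eq hθ.1 hθ.2 hη.1 hη.2 (by linarith) ?_
  rw [div_eq_div_iff (by positivity) (by positivity)]
  field_simp at h4
  linarith

/-- Strong consistency for an arbitrary contrast: almost surely the empirical contrast converges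
uniformly on `Θ` to the limit contrast, whose only minimizer on `Θ` is the true parameter. -/
lemma ae_tendsto_argmin_contrast (hΦ : IsContrast H Φ) (hδ : 0 < δ)
    (hθ : θstar ∈ paramSpace δ) (hmodel : IsPoisoningModel P θstar X Y0 Y1)
    (hlin : LinInd H (cdf1 P Y0) (cdf1 P Y1) (cdf2 P Y0)) (θhat : ℕ → Ω → ℝ × ℝ)
    (hhat : ∀ n : ℕ, 2 ≤ n → ∀ ω : Ω, θhat n ω ∈
      argminOn (fun θ => Φ fun w => empDev (cdf1 P Y0) (cdf2 P Y0)
        (fun i => observed X Y0 Y1 i ω) n θ w.1 w.2) (paramSpace δ)) :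
    ∀ᵐ ω ∂P, Tendsto (fun n => θhat n ω) atTop (𝓝 θstar) := by
  have hpos := pos_of_mem_paramSpace hδ hθ
  have hs : 0 < θstar.1 + θstar.2 := add_pos hpos.1.1 hpos.2.1
  have hZ := measurable_observed hmodel
  have mF0 := measurable_cdf1 (P := P) hmodel.measurable_Y0
  have mG0 := measurable_cdf2 (P := P) hmodel.measurable_Y0
  have mF := measurable_cdf1 (P := P) hZ
  have mG := measurable_cdf2 (P := P) hZ
  have hF := cdf1_observed hmodel hs.ne'
  have hG := cdf2_observed hmodel
  -- the limit contrast vanishes at the true parameter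
  have hzero : deviation (cdf1 P Y0) (fun w => cdf2 P Y0 w.1 w.2) (cdf1 P (observed X Y0 Y1))
      (fun w => cdf2 P (observed X Y0 Y1) w.1 w.2) θstar = 0 := by
    funext w
    have hr : rOf θstar ≠ 0 := (div_pos hpos.1.1 hs).ne'
    rw [deviation_eq_of_mixture ⟨hpos.1.1, hpos.2.1⟩ ⟨hpos.1.1, hpos.2.1⟩ hF hG, div_self hr]
    simp
  filter_upwards [ae_tendstoUniformly_empCdf hmodel hs (by linarith [hpos.1.2, hpos.2.2])]
    with ω hω
  simp_rw [empDev_eq_deviation] at hhat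
  refine tendsto_of_argmin (isCompact_paramSpace δ)
    (hΦ.continuousOn_deviation hδ mF0 mG0 mF mG abs_cdf1_le_one abs_cdf2_le_one abs_cdf1_le_one
      abs_cdf2_le_one)
    (hΦ.tendstoUniformlyOn_deviation hδ mF0 mG0 mF mG (measurable_empCdf1 _)
      (measurable_empCdf2 _) abs_cdf1_le_one abs_cdf2_le_one abs_cdf1_le_one abs_cdf2_le_one
      (Eventually.of_forall fun n x => by
        rw [empCdf1_eq_pairFreq]; exact abs_pairFreq_le_one _ _ _)
      ?_ hω.1 hω.2) hθ ?_ ?_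
  · filter_upwards [eventually_ge_atTop 1] with n hn w
    rw [empCdf2_eq_pairFreq _ hn]
    exact abs_pairFreq_le_one _ _ _
  · intro θ hθ' hle
    have hpos' := pos_of_mem_paramSpace hδ hθ'
    have hm := measurable_deviation mF0 mG0 mF mG θ
    simp only [hzero, hΦ.map_zero] at hle
    exact hlin.eq_of_ae_eq_zero ⟨hpos.1.1, hpos.2.1⟩ ⟨hpos'.1.1, hpos'.2.1⟩ hF hG hm
      (hΦ.ae_eq_zero _ _ hm (abs_deviation_le abs_cdf1_le_one abs_cdf2_le_one abs_cdf1_le_one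
        abs_cdf2_le_one θ) hle)
  · filter_upwards [eventually_ge_atTop 2] with n hn
    exact ⟨(hhat n hn ω).1, (hhat n hn ω).2 θstar hθ⟩

end Consistency

end Poisoning

end

theorem theorem1 {Ω : Type*} [MeasurableSpace Ω] (P : Measure Ω) [IsProbabilityMeasure P]
    (E : Set ℝ) (H : Measure (E × E)) [IsProbabilityMeasure H]
    (δ : ℝ) (hδ0 : 0 < δ) (hδ1 : δ < 1 / 2)
    (θstar : ℝ × ℝ) (hθ : θstar ∈ Poisoning.paramSpace δ)
    (X : ℕ → Ω → Fin 2) (Y0 Y1 : ℕ → Ω → E)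
    (hmodel : Poisoning.IsPoisoningModel P θstar X Y0 Y1)
    (hstat : Poisoning.IsStationaryProcess P (Poisoning.observed X Y0 Y1))
    (hlin : Poisoning.LinInd H (Poisoning.cdf1 P Y0) (Poisoning.cdf1 P Y1)
      (Poisoning.cdf2 P Y0)) :
    -- the minimizers defining the two estimators exist
    (∀ n : ℕ, 2 ≤ n → ∀ ω : Ω,
      (Poisoning.argminOn (Poisoning.empD H (Poisoning.cdf1 P Y0) (Poisoning.cdf2 P Y0)
        (fun i => Poisoning.observed X Y0 Y1 i ω) n) (Poisoning.paramSpace δ)).Nonempty ∧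
      (Poisoning.argminOn (Poisoning.empS (Poisoning.cdf1 P Y0) (Poisoning.cdf2 P Y0)
        (fun i => Poisoning.observed X Y0 Y1 i ω) n) (Poisoning.paramSpace δ)).Nonempty) ∧
    -- every choice of minimizers of the integrated squared contrast is strongly consistent
    (∀ θhat : ℕ → Ω → ℝ × ℝ,
      (∀ n : ℕ, 2 ≤ n → ∀ ω : Ω, θhat n ω ∈
        Poisoning.argminOn (Poisoning.empD H (Poisoning.cdf1 P Y0) (Poisoning.cdf2 P Y0)
          (fun i => Poisoning.observed X Y0 Y1 i ω) n) (Poisoning.paramSpace δ)) →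
      ∀ᵐ ω ∂P, Tendsto (fun n => θhat n ω) atTop (𝓝 θstar)) ∧
    -- every choice of minimizers of the sup contrast is strongly consistent
    (∀ θtilde : ℕ → Ω → ℝ × ℝ,
      (∀ n : ℕ, 2 ≤ n → ∀ ω : Ω, θtilde n ω ∈
        Poisoning.argminOn (Poisoning.empS (Poisoning.cdf1 P Y0) (Poisoning.cdf2 P Y0)
          (fun i => Poisoning.observed X Y0 Y1 i ω) n) (Poisoning.paramSpace δ)) →
      ∀ᵐ ω ∂P, Tendsto (fun n => θtilde n ω) atTop (𝓝 θstar)) := by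
  have hE : Nonempty E := (nonempty_of_isProbabilityMeasure P).map (Y0 0)
  have hd := Poisoning.isContrast_integral_sq H
  have hs := Poisoning.isContrast_iSup_abs H
  exact ⟨fun n hn ω =>
      ⟨Poisoning.argminOn_contrast_nonempty hd hδ0 hδ1 hmodel.measurable_Y0 hn _,
        Poisoning.argminOn_contrast_nonempty hs hδ0 hδ1 hmodel.measurable_Y0 hn _⟩,
    Poisoning.ae_tendsto_argmin_contrast hd hδ0 hθ hmodel hlin,
    Poisoning.ae_tendsto_argmin_contrast hs hδ0 hθ hmodel hlin⟩
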